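/- Let $k$ be a field. For a submonoid $H\subseteq\mathbb N$ let $k[[H]]\subseteq k[[t]]$ be the ring of power series whose exponents lie in $H$. A finitely generated module $C$ over a commutative ring $R$ is semidualizing if the homothety map $R\to\operatorname{Hom}_R(C,C)$ is an isomorphism and $\operatorname{Ext}^i_R(C,C)=0$ for all $i>0$; if $R$ is a Cohen–Macaulay local ring with canonical module $K$, a semidualizing module $C$ is nontrivial if $C\not\cong R$ and $C\not\cong K$. Let $A,B\subseteq\mathbb N$ be such that the submonoids $\langle A\rangle$ and $\langle B\rangle$ of $\mathbb N$ that they generate are numerical semigroups (that is, the greatest common divisor of their elements is $1$). Let $a\in\langle A\rangle$ and $b\in\langle B\rangle$ with $\gcd(a,b)=1$, and let $H=\langle bA, aB\rangle$ be the corresponding gluing, where $bA=\{bx: x\in A\}$ and $aB=\{ay: y\in B\}$. Let $I_1\subseteq k((t))$ be a $k[[\langle A\rangle]]$-submodule and $I_2\subseteq k((t))$ a $k[[\langle B\rangle]]$-submodule, each generated by monomials $t^r$ ($r\in\mathbb Z$), and suppose that $I_1$ and $I_2$ are semidualizing over $k[[\langle A\rangle]]$ and $k[[\langle B\rangle]]$,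 respectively. Then the $k[[H]]$-submodule $$I=\left(t^{br+as} : r,s\in\mathbb Z,\ t^r\in I_1,\ t^s\in I_2\right)\subseteq k((t))$$ is a semidualizing $k[[H]]$-module, and $I$ is nontrivial if $I_1$ or $I_2$ is nontrivial. Moreover, if $k[[\langle A\rangle]]$ or $k[[\langle B\rangle]]$ has a nontrivial semidualizing module (not necessarily generated by monomials), then so does $k[[H]]$. -/

import Mathlib

open CategoryTheory

universe u

/-- A submonoid of `ℕ` is a numerical semigroup if the greatest common divisor of its elements
is `1`. -/
def IsNumericalSemigroup (H : AddSubmonoid ℕ) : Prop :=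
  ∀ d : ℕ, (∀ h ∈ H, d ∣ h) → d = 1

/-- The submonoid `⟨bA, aB⟩` of `ℕ` generated by `{b x : x ∈ A} ∪ {a y : y ∈ B}`. -/
def gluedMonoid (A B : Set ℕ) (a b : ℕ) : AddSubmonoid ℕ :=
  AddSubmonoid.closure ((fun x => b * x) '' A ∪ (fun y => a * y) '' B)

section SemigroupRing

variable (k : Type u) [Field k] (H : AddSubmonoid ℕ)

/-- The ring `k[[H]]`: the subalgebra of `k[[t]]` of all power series whose exponents lie
in `H`. -/
noncomputable def semigroupRing : Subalgebra k (PowerSeries k) where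
  carrier := {f | ∀ n : ℕ, PowerSeries.coeff n f ≠ 0 → n ∈ H}
  mul_mem' := by
    intro f g hf hg n hn
    rw [PowerSeries.coeff_mul] at hn
    obtain ⟨p, hp, hne⟩ := Finset.exists_ne_zero_of_sum_ne_zero hn
    rw [← Finset.HasAntidiagonal.mem_antidiagonal.mp hp]
    exact H.add_mem (hf _ (left_ne_zero_of_mul hne)) (hg _ (right_ne_zero_of_mul hne))
  add_mem' := by
    intro f g hf hg n hn
    by_cases h : PowerSeries.coeff n f = 0
    · refine hg n fun h' => hn ?_
      rw [map_add, h, h', add_zero]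
    · exact hf n h
  algebraMap_mem' := by
    intro c n hn
    have h0 : n = 0 := by
      by_contra h
      exact hn (by simp [PowerSeries.coeff_C, h])
    rw [h0]
    exact H.zero_mem

theorem inv_mem_semigroupRing {f : PowerSeries k} (hf : f ∈ semigroupRing k H) :
    f⁻¹ ∈ semigroupRing k H := by
  intro n
  induction n using Nat.strong_induction_on with
  | _ n ih =>
    intro hn
    rw [PowerSeries.coeff_inv] at hn
    split_ifs at hn with h0
    · rw [h0]
      exact H.zero_mem
    · obtain ⟨p, hp, hne⟩ := Finset.exists_ne_zero_of_sum_ne_zero (right_ne_zero_of_mul hn)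
      split_ifs at hne with hlt
      · rw [← Finset.HasAntidiagonal.mem_antidiagonal.mp hp]
        exact H.add_mem (hf _ (left_ne_zero_of_mul hne)) (ih _ hlt (right_ne_zero_of_mul hne))
      · exact absurd rfl hne

/-- The ring `k[[H]]` is local. -/
instance isLocalRing_semigroupRing : IsLocalRing (semigroupRing k H) := by
  have key : ∀ x : semigroupRing k H,
      PowerSeries.constantCoeff (x : PowerSeries k) ≠ 0 → IsUnit x := by
    intro x hx
    refine IsUnit.of_mul_eq_one
      (⟨(x : PowerSeries k)⁻¹, inv_mem_semigroupRing k H x.2⟩ : semigroupRing k H) ?_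
    exact Subtype.ext (PowerSeries.mul_inv_cancel _ hx)
  refine IsLocalRing.of_isUnit_or_isUnit_one_sub_self fun x => ?_
  by_cases hx : PowerSeries.constantCoeff (x : PowerSeries k) = 0
  · right
    refine key _ ?_
    simp [hx]
  · exact Or.inl (key x hx)

/-- The monomial `t ^ r`, for an integer `r`, in the field `k((t))` of Laurent series, which is
the field of fractions of `k[[H]]` when `H` is a numerical semigroup. -/
noncomputable def monomialT (r : ℤ) : LaurentSeries k :=
  HahnSeries.single r 1

/-- A `k[[H]]`-submodule of `k((t))` is monomial if it is generated by monomials. -/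
def IsMonomialModule {k : Type u} [Field k] {H : AddSubmonoid ℕ}
    (I : Submodule (semigroupRing k H) (LaurentSeries k)) : Prop :=
  ∃ E : Set ℤ, I = Submodule.span (semigroupRing k H) (monomialT k '' E)

/-- The `k[[⟨bA, aB⟩]]`-submodule `(t ^ (b r + a s) : t ^ r ∈ I₁, t ^ s ∈ I₂)` of `k((t))`. -/
noncomputable def gluedModule {k : Type u} [Field k] (A B : Set ℕ) (a b : ℕ)
    (I₁ : Submodule (semigroupRing k (AddSubmonoid.closure A)) (LaurentSeries k))
    (I₂ : Submodule (semigroupRing k (AddSubmonoid.closure B)) (LaurentSeries k)) :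
    Submodule (semigroupRing k (gluedMonoid A B a b)) (LaurentSeries k) :=
  Submodule.span (semigroupRing k (gluedMonoid A B a b))
    {m | ∃ r s : ℤ, monomialT k r ∈ I₁ ∧ monomialT k s ∈ I₂ ∧
      m = monomialT k ((b : ℤ) * r + (a : ℤ) * s)}

end SemigroupRing

section Modules

variable (R : Type u) [CommRing R] (C : Type u) [AddCommGroup C] [Module R C]

/-- Semidualizing modules. -/
structure IsSemidualizing : Prop where
  finite : Module.Finite R C
  /-- The homothety map `R → Hom_R(C, C)`, `r ↦ (c ↦ r c)`, is an isomorphism. -/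
  homothety : Function.Bijective (LinearMap.lsmul R C : R →ₗ[R] C →ₗ[R] C)
  ext_eq_zero : ∀ i : ℕ, 0 < i →
    Subsingleton (Abelian.Ext (ModuleCat.of R C) (ModuleCat.of R C) i)

/-- `C` is a canonical module of the (Cohen-Macaulay) local ring `R` of dimension `d`, with
residue field `k`: it is finitely generated, and `Ext^i_R(k, C)` is zero for `i ≠ d` and is
one-dimensional over `k` for `i = d`. Equivalently, `C` is maximal Cohen-Macaulay of type one and
of finite injective dimension. Such a module is unique up to isomorphism. -/
structure IsCanonicalModule [IsLocalRing R] : Prop where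
  finite : Module.Finite R C
  ext_eq_zero : ∀ i : ℕ, (i : WithBot ℕ∞) ≠ ringKrullDim R →
    Subsingleton (Abelian.Ext (ModuleCat.of R (IsLocalRing.ResidueField R)) (ModuleCat.of R C) i)
  ext_dim : ∀ i : ℕ, (i : WithBot ℕ∞) = ringKrullDim R →
    Nonempty (Abelian.Ext (ModuleCat.of R (IsLocalRing.ResidueField R)) (ModuleCat.of R C) i
      ≃ₗ[R] IsLocalRing.ResidueField R)

/-- A semidualizing module is nontrivial if it is isomorphic neither to `R` nor to the canonical
module of `R`. -/
structure IsNontrivialSemidualizing [IsLocalRing R] : Prop where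
  semidualizing : IsSemidualizing R C
  not_free : ¬ Nonempty (C ≃ₗ[R] R)
  not_canonical : ¬ IsCanonicalModule R C

/-- The local ring `R` has a nontrivial semidualizing module. -/
def HasNontrivialSemidualizing [IsLocalRing R] : Prop :=
  ∃ (D : Type u) (_ : AddCommGroup D) (_ : Module R D), IsNontrivialSemidualizing R D

end Modules

/-! Write R₁ = k[[⟨A⟩]], R₂ = k[[⟨B⟩]], R = k[[H]], L = k[[t]], and suppose a, b ≠ 0. Let L → R₁ and
R₂ → R be t ↦ t^a, and let L → R₂ and R₁ → R be t ↦ t^b. The least exponents in the residue classes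
modulo a (an Apéry set) give a finite monomial L-basis of R₁, and likewise of I₁; the same holds
modulo b for R₂ and I₂. Since a and b are coprime, the sums b w₁ + a w₂ are an Apéry set modulo ab
(`IsApery.glue`). Hence R = R₁ ⊗_L R₂ and I = I₁ ⊗_L I₂, with all factors finite and free over the
discrete valuation ring L. The rest is commutative algebra of such tensor products M = M₁ ⊗_L M₂.

Semidualizing: M = P ⊗_{R₂} M₂ with P = R ⊗_{R₁} M₁ flat over R₂. Over R₁ the module M is a power of
M₁, so Ext_R^i(P, M) = Ext_{R₁}^i(M₁, M) = 0 for i > 0, while Hom_R(P, M) = Hom_{R₁}(M₁, M) = M₂ ⊗_L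
R₁ is a power of M₂ over R₂. A second change of rings (`extVanish_tensor_iff`) reduces Ext_R^i(M, M)
to Ext_{R₂}^i(M₂, M₂)^n = 0. The same identification of Hom gives the homothety isomorphism.

Nontriviality: M₁ is a direct summand of M over R₁. If M ≅ R, then M₁ is projective, hence free,
hence of rank one. If M is canonical over R, flat base change gives the vanishing of Ext_{R₁}^i(k,
M₁) for i ≥ 2, and tensoring with a socle element of M₂/ϖM₂ shows that the type of M₁ is one; in
dimension one this says that M₁ is canonical.

An arbitrary nontrivial D over R₁ is glued with R₂ itself. This needs D free over L, which holds
because semidualizing modules are torsion-free (`IsSemidualizing.isSMulRegular`). If a or b is 0,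
the other is 1, one semigroup is ℕ and the gluing changes nothing. -/

set_option linter.unusedSectionVars false

/-! ### Vanishing of Ext: retracts, finite powers, dimension shifting -/

section ExtGeneral

/-- The vanishing of `Ext^i_R(M, N)`. -/
abbrev ExtVanish (R : Type u) [CommRing R] (M N : Type u) [AddCommGroup M] [Module R M]
    [AddCommGroup N] [Module R N] (i : ℕ) : Prop :=
  Subsingleton (Abelian.Ext (ModuleCat.of R M) (ModuleCat.of R N) i)

variable {R : Type u} [CommRing R] {M M' N N' K F : Type u}
  [AddCommGroup M] [Module R M] [AddCommGroup M'] [Module R M']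
  [AddCommGroup N] [Module R N] [AddCommGroup N'] [Module R N']
  [AddCommGroup K] [Module R K] [AddCommGroup F] [Module R F]

open Abelian in
theorem ExtVanish.of_retract_left {i : ℕ} (h : ExtVanish R M' N i) (ι : M →ₗ[R] M')
    (π : M' →ₗ[R] M) (hπ : π ∘ₗ ι = LinearMap.id) : ExtVanish R M N i := by
  refine ⟨fun x y => ?_⟩
  have key : ∀ z : Ext (ModuleCat.of R M) (ModuleCat.of R N) i,
      z = (Ext.mk₀ (ModuleCat.ofHom ι)).comp
        ((Ext.mk₀ (ModuleCat.ofHom π)).comp z (zero_add i)) (zero_add i) := by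
    intro z
    rw [Ext.mk₀_comp_mk₀_assoc, ← ModuleCat.ofHom_comp, hπ, ModuleCat.ofHom_id, Ext.mk₀_id_comp]
  rw [key x, key y, h.elim ((Ext.mk₀ (ModuleCat.ofHom π)).comp x (zero_add i))]

open Abelian in
theorem ExtVanish.of_retract_right {i : ℕ} (h : ExtVanish R M N' i) (ι : N →ₗ[R] N')
    (π : N' →ₗ[R] N) (hπ : π ∘ₗ ι = LinearMap.id) : ExtVanish R M N i := by
  refine ⟨fun x y => ?_⟩
  have key : ∀ z : Ext (ModuleCat.of R M) (ModuleCat.of R N) i,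
      z = (z.comp (Ext.mk₀ (ModuleCat.ofHom ι)) (add_zero i)).comp
        (Ext.mk₀ (ModuleCat.ofHom π)) (add_zero i) := by
    intro z
    rw [Ext.comp_assoc_of_third_deg_zero, Ext.mk₀_comp_mk₀, ← ModuleCat.ofHom_comp, hπ,
      ModuleCat.ofHom_id, Ext.comp_mk₀_id]
  rw [key x, key y, h.elim (x.comp (Ext.mk₀ (ModuleCat.ofHom ι)) (add_zero i))]

theorem ExtVanish.congr_left {i : ℕ} (e : M ≃ₗ[R] M') :
    ExtVanish R M N i ↔ ExtVanish R M' N i :=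
  ⟨fun h => h.of_retract_left e.symm.toLinearMap e.toLinearMap (by ext; simp),
    fun h => h.of_retract_left e.toLinearMap e.symm.toLinearMap (by ext; simp)⟩

theorem ExtVanish.congr_right {i : ℕ} (e : N ≃ₗ[R] N') :
    ExtVanish R M N i ↔ ExtVanish R M N' i :=
  ⟨fun h => h.of_retract_right e.symm.toLinearMap e.toLinearMap (by ext; simp),
    fun h => h.of_retract_right e.toLinearMap e.symm.toLinearMap (by ext; simp)⟩

open Abelian in
theorem ExtVanish.pi_left {i : ℕ} (h : ExtVanish R M N i) (J : Type) [Finite J] :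
    ExtVanish R (J → M) N i := by
  classical
  cases nonempty_fintype J
  refine ⟨fun x y => ?_⟩
  have hid : (𝟙 (ModuleCat.of R (J → M))) = ∑ j : J, ModuleCat.ofHom (LinearMap.proj j) ≫
      ModuleCat.ofHom (LinearMap.single R (fun _ : J => M) j) := by
    ext f j
    simp [Pi.single_apply, ModuleCat.hom_sum]
  have key : ∀ z : Ext (ModuleCat.of R (J → M)) (ModuleCat.of R N) i, z = 0 := by
    intro z
    rw [← Ext.mk₀_id_comp z, hid, Ext.mk₀_sum, Ext.sum_comp]
    refine Finset.sum_eq_zero fun j _ => ?_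
    rw [← Ext.mk₀_comp_mk₀_assoc, h.elim ((Ext.mk₀ _).comp z _) 0, Ext.comp_zero]
  rw [key x, key y]

open Abelian in
theorem ExtVanish.pi_right {i : ℕ} (h : ExtVanish R M N i) (J : Type) [Finite J] :
    ExtVanish R M (J → N) i := by
  classical
  cases nonempty_fintype J
  refine ⟨fun x y => ?_⟩
  have hid : (𝟙 (ModuleCat.of R (J → N))) = ∑ j : J, ModuleCat.ofHom (LinearMap.proj j) ≫
      ModuleCat.ofHom (LinearMap.single R (fun _ : J => N) j) := by
    ext f j
    simp [Pi.single_apply, ModuleCat.hom_sum]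
  have key : ∀ z : Ext (ModuleCat.of R M) (ModuleCat.of R (J → N)) i, z = 0 := by
    intro z
    rw [← Ext.comp_mk₀_id z, hid, Ext.mk₀_sum, Ext.comp_sum]
    refine Finset.sum_eq_zero fun j _ => ?_
    rw [← Ext.mk₀_comp_mk₀, ← Ext.comp_assoc_of_second_deg_zero,
      h.elim (z.comp (Ext.mk₀ _) _) 0, Ext.zero_comp]
  rw [key x, key y]

theorem ExtVanish.of_projective [Module.Projective R M] {i : ℕ} (hi : 0 < i) :
    ExtVanish R M N i := by
  obtain ⟨n, rfl⟩ := Nat.exists_eq_succ_of_ne_zero hi.ne'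
  exact ⟨fun x y => by
    rw [Abelian.Ext.eq_zero_of_projective x, Abelian.Ext.eq_zero_of_projective y]⟩

theorem shortExact_of_exact {ι : K →ₗ[R] F} {g : F →ₗ[R] M} (hι : Function.Injective ι)
    (hg : Function.Surjective g) (h : Function.Exact ι g) :
    (ShortComplex.mk (ModuleCat.ofHom ι) (ModuleCat.ofHom g) (by
      ext x; exact h.apply_apply_eq_zero x)).ShortExact := by
  refine ShortComplex.ShortExact.mk' ?_ ?_ ?_
  · rw [ShortComplex.ShortExact.moduleCat_exact_iff_function_exact]
    exact h
  · exact (ModuleCat.mono_iff_injective _).2 hι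
  · exact (ModuleCat.epi_iff_surjective _).2 hg

open Abelian in
/-- If `Ext^1(F, N) = 0` and `0 → K → F → M → 0` is exact, then `Ext^1(M, N) = 0` if and only if
every map `K → N` extends to `F`. -/
theorem extVanish_one_iff {ι : K →ₗ[R] F} {g : F →ₗ[R] M} (hι : Function.Injective ι)
    (hg : Function.Surjective g) (h : Function.Exact ι g) (hF : ExtVanish R F N 1) :
    ExtVanish R M N 1 ↔ ∀ f : K →ₗ[R] N, ∃ f' : F →ₗ[R] N, f' ∘ₗ ι = f := by
  have hS := shortExact_of_exact hι hg h
  constructor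
  · intro hM f
    obtain ⟨x, hx⟩ := Ext.contravariant_sequence_exact₁ hS (ModuleCat.of R N)
      (Ext.mk₀ (ModuleCat.ofHom f)) (add_zero 1) (hM.elim _ _)
    obtain ⟨f', rfl⟩ := Ext.mk₀_bijective _ _ |>.2 x
    refine ⟨f'.hom, ?_⟩
    rw [Ext.mk₀_comp_mk₀] at hx
    have := (Ext.mk₀_bijective _ _).1 hx
    exact congrArg ModuleCat.Hom.hom this
  · intro H
    have key : ∀ z : Ext (ModuleCat.of R M) (ModuleCat.of R N) 1, z = 0 := by
      intro z
      obtain ⟨y, rfl⟩ := Ext.contravariant_sequence_exact₃ hS (ModuleCat.of R N) z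
        (hF.elim _ _) (add_zero 1)
      obtain ⟨f, rfl⟩ := Ext.mk₀_bijective _ _ |>.2 y
      obtain ⟨f', hf'⟩ := H f.hom
      obtain rfl : f = ModuleCat.ofHom ι ≫ ModuleCat.ofHom f' :=
        (congrArg ModuleCat.ofHom hf').symm
      rw [← Ext.mk₀_comp_mk₀]
      exact hS.extClass_comp_assoc _
    exact ⟨fun x y => by rw [key x, key y]⟩

open Abelian in
/-- Dimension shifting. -/
theorem extVanish_succ_iff {ι : K →ₗ[R] F} {g : F →ₗ[R] M} (hι : Function.Injective ι)
    (hg : Function.Surjective g) (h : Function.Exact ι g) {i : ℕ} (hF : ExtVanish R F N i)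
    (hF' : ExtVanish R F N (i + 1)) :
    ExtVanish R M N (i + 1) ↔ ExtVanish R K N i := by
  have hS := shortExact_of_exact hι hg h
  constructor
  · intro hM
    have key : ∀ z : Ext (ModuleCat.of R K) (ModuleCat.of R N) i, z = 0 := by
      intro z
      obtain ⟨y, rfl⟩ := Ext.contravariant_sequence_exact₁ hS (ModuleCat.of R N)
        z (add_comm 1 i) (hM.elim _ _)
      rw [hF.elim y 0, Ext.comp_zero]
    exact ⟨fun x y => by rw [key x, key y]⟩
  · intro hK
    have key : ∀ z : Ext (ModuleCat.of R M) (ModuleCat.of R N) (i + 1), z = 0 := by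
      intro z
      obtain ⟨y, rfl⟩ := Ext.contravariant_sequence_exact₃ hS (ModuleCat.of R N) z
        (hF'.elim _ _) (add_comm 1 i)
      rw [hK.elim y 0, Ext.comp_zero]
    exact ⟨fun x y => by rw [key x, key y]⟩

open Abelian in
theorem ExtVanish.of_exact {ι : K →ₗ[R] F} {g : F →ₗ[R] M} (hι : Function.Injective ι)
    (hg : Function.Surjective g) (h : Function.Exact ι g) {i : ℕ} (hK : ExtVanish R K N i)
    (hM : ExtVanish R M N i) : ExtVanish R F N i := by
  have hS := shortExact_of_exact hι hg h
  have key : ∀ z : Ext (ModuleCat.of R F) (ModuleCat.of R N) i, z = 0 := by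
    intro z
    obtain ⟨y, rfl⟩ := Ext.contravariant_sequence_exact₂ hS (ModuleCat.of R N) z (hK.elim _ _)
    rw [hM.elim y 0, Ext.comp_zero]
  exact ⟨fun x y => by rw [key x, key y]⟩

end ExtGeneral

/-! ### Change of rings for Ext -/

section Transfer

open TensorProduct

variable {S R : Type u} [CommRing S] [CommRing R] [Algebra S R]
  {P X Y : Type u} [AddCommGroup P] [Module R P] [Module S P] [IsScalarTower S R P]
  [AddCommGroup X] [Module R X] [Module S X] [IsScalarTower S R X]
  [AddCommGroup Y] [Module S Y]

/-- If `P` is an `R`-module that is flat over `S` and `Ext_R^i(P, X) = 0` for `i > 0`, then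
`Ext_R^i(P ⊗_S M, X)` vanishes if and only if `Ext_S^i(M, Hom_R(P, X))` does. -/
theorem extVanish_tensor_iff [IsNoetherianRing S] [Module.Flat S P]
    (hP : ∀ i, 0 < i → ExtVanish R P X i) (e : Y ≃ₗ[S] (P →ₗ[R] X)) {i : ℕ} (hi : 0 < i)
    (M : Type u) [AddCommGroup M] [Module S M] [Module.Finite S M] :
    ExtVanish R (P ⊗[S] M) X i ↔ ExtVanish S M Y i := by
  have hfree : ∀ (n i : ℕ), 0 < i → ExtVanish R (P ⊗[S] (Fin n → S)) X i := fun n i hi =>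
    (ExtVanish.congr_left (TensorProduct.piScalarRight S R P (Fin n))).2
      ((hP i hi).pi_left (Fin n))
  induction i, hi using Nat.le_induction generalizing M with
  | base =>
    obtain ⟨n, g, hg⟩ := Module.Finite.exists_fin' S M
    have hex : Function.Exact (LinearMap.ker g).subtype g := LinearMap.exact_subtype_ker_map g
    have hinj : Function.Injective (LinearMap.ker g).subtype := Subtype.val_injective
    rw [extVanish_one_iff hinj hg hex (ExtVanish.of_projective one_pos),
      extVanish_one_iff (ι := AlgebraTensorModule.lTensor R P (LinearMap.ker g).subtype)
        (g := AlgebraTensorModule.lTensor R P g)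
        (Module.Flat.lTensor_preserves_injective_linearMap _ hinj)
        (LinearMap.lTensor_surjective P hg) (lTensor_exact P hex hg) (hfree n 1 one_pos)]
    -- Maps P ⊗ K → X are the same as maps K → Hom_R(P, X) ≅ Y, so the two extension problems
    -- coincide. Degree one is treated this way because dimension shifting would need Hom to vanish.
    constructor
    · intro H f
      obtain ⟨f', hf'⟩ := H (AlgebraTensorModule.lift (e.toLinearMap ∘ₗ f).flip)
      refine ⟨e.symm.toLinearMap ∘ₗ (AlgebraTensorModule.curry f').flip, ?_⟩
      ext x
      apply e.injective
      ext p
      simpa using LinearMap.congr_fun hf' (p ⊗ₜ[S] x)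
    · intro H f
      obtain ⟨f', hf'⟩ := H (e.symm.toLinearMap ∘ₗ (AlgebraTensorModule.curry f).flip)
      refine ⟨AlgebraTensorModule.lift (e.toLinearMap ∘ₗ f').flip, ?_⟩
      ext p x
      have := LinearMap.congr_fun (congrArg e (LinearMap.congr_fun hf' x)) p
      simpa using this
  | succ i hi ih =>
    obtain ⟨n, g, hg⟩ := Module.Finite.exists_fin' S M
    have hex : Function.Exact (LinearMap.ker g).subtype g := LinearMap.exact_subtype_ker_map g
    have hinj : Function.Injective (LinearMap.ker g).subtype := Subtype.val_injective
    rw [extVanish_succ_iff hinj hg hex (ExtVanish.of_projective hi)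
        (ExtVanish.of_projective i.succ_pos),
      extVanish_succ_iff (ι := AlgebraTensorModule.lTensor R P (LinearMap.ker g).subtype)
        (g := AlgebraTensorModule.lTensor R P g)
        (Module.Flat.lTensor_preserves_injective_linearMap _ hinj)
        (LinearMap.lTensor_surjective P hg) (lTensor_exact P hex hg) (hfree n i hi)
        (hfree n (i + 1) i.succ_pos)]
    -- The kernel is again finitely generated because S is Noetherian, and flatness of P keeps the
    -- tensored sequence exact.
    exact ih (LinearMap.ker g)

end Transfer

/-! ### Socles, and canonical modules in dimension one -/

section LocalRing

open IsLocalRing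

/-- The submodule of elements of `V` killed by the maximal ideal is isomorphic to the residue
field. -/
def HasSimpleSocle (R V : Type*) [CommRing R] [IsLocalRing R] [AddCommGroup V] [Module R V] :
    Prop :=
  ∃ s : V, s ≠ 0 ∧ (∀ r ∈ maximalIdeal R, r • s = 0) ∧
    ∀ x : V, (∀ r ∈ maximalIdeal R, r • x = 0) → ∃ r : R, x = r • s

section

variable {R V : Type*} [CommRing R] [IsLocalRing R] [AddCommGroup V] [Module R V]

/-- The map from the residue field that sends `1` to a given socle element. -/
noncomputable def residueFieldLift (s : V) (hs : ∀ r ∈ maximalIdeal R, r • s = 0) :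
    ResidueField R →ₗ[R] V :=
  Submodule.liftQ (maximalIdeal R) (LinearMap.toSpanSingleton R V s) fun r hr => by
    simpa using hs r hr

@[simp]
theorem residueFieldLift_residue (s : V) (hs : ∀ r ∈ maximalIdeal R, r • s = 0) (r : R) :
    residueFieldLift s hs (residue R r) = r • s := by
  rfl

theorem residueField_hom_ext {f g : ResidueField R →ₗ[R] V} (h : f 1 = g 1) : f = g := by
  ext x
  obtain ⟨r, rfl⟩ := residue_surjective x
  have : residue R r = r • (1 : ResidueField R) := by
    rw [Algebra.smul_def, mul_one]; rfl
  rw [this, map_smul, map_smul, h]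

theorem residueField_smul_eq_zero {r : R} (hr : r ∈ maximalIdeal R) (x : ResidueField R) :
    r • x = 0 := by
  rw [Algebra.smul_def]
  have : algebraMap R (ResidueField R) r = 0 := (residue_eq_zero_iff r).2 hr
  rw [this, zero_mul]

/-- A map out of the residue field is determined by the image of 1, which can be any socle element;
so Hom(k, V) is the socle of V. -/
theorem hasSimpleSocle_iff :
    HasSimpleSocle R V ↔
      Nonempty ((ResidueField R →ₗ[R] V) ≃ₗ[R] ResidueField R) := by
  constructor
  · rintro ⟨s, hs0, hs, hs'⟩
    let σ := residueFieldLift s hs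
    let Φ : ResidueField R →ₗ[R] (ResidueField R →ₗ[R] V) :=
      (LinearMap.compRight R σ) ∘ₗ (LinearMap.mul R (ResidueField R))
    refine ⟨(LinearEquiv.ofBijective Φ ⟨?_, ?_⟩).symm⟩
    · rw [injective_iff_map_eq_zero]
      intro c hc
      obtain ⟨r, rfl⟩ := residue_surjective c
      have h1 : σ (residue R r * 1) = 0 := LinearMap.congr_fun hc 1
      rw [mul_one] at h1
      rw [residue_eq_zero_iff]
      by_contra hr
      have hu : IsUnit r := by simpa using hr
      rw [residueFieldLift_residue] at h1
      exact hs0 ((hu.smul_eq_zero).1 h1)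
    · intro f
      obtain ⟨r, hr⟩ := hs' (f 1) fun r hr => by
        rw [← map_smul, residueField_smul_eq_zero hr, map_zero]
      refine ⟨residue R r, residueField_hom_ext ?_⟩
      change σ (residue R r * 1) = f 1
      rw [mul_one, hr, residueFieldLift_residue]
  · rintro ⟨e⟩
    refine ⟨e.symm 1 1, ?_, ?_, ?_⟩
    · intro h
      have h0 : e.symm 1 = 0 := residueField_hom_ext h
      exact one_ne_zero ((LinearEquiv.map_eq_zero_iff _).1 h0)
    · intro r hr
      rw [← map_smul, residueField_smul_eq_zero hr, map_zero]
    · intro x hx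
      obtain ⟨r, hr⟩ := residue_surjective (e (residueFieldLift x hx))
      refine ⟨r, ?_⟩
      have h1 : residueFieldLift x hx = r • e.symm 1 := by
        apply e.injective
        rw [map_smul, LinearEquiv.apply_symm_apply, ← hr, Algebra.smul_def, mul_one]
        rfl
      have := LinearMap.congr_fun h1 1
      rw [← map_one (residue R), residueFieldLift_residue, one_smul] at this
      exact this

/-- An Artinian module contains a simple submodule, which over a local ring is a copy of the residue
field. -/
theorem exists_socle_ne_zero [IsArtinian R V] [Nontrivial V] :
    ∃ s : V, s ≠ 0 ∧ ∀ r ∈ maximalIdeal R, r • s = 0 := by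
  obtain ⟨A, hA, -⟩ := (eq_bot_or_exists_atom_le (⊤ : Submodule R V)).resolve_left top_ne_bot
  have : IsSimpleModule R A := isSimpleModule_iff_isAtom.2 hA
  obtain ⟨I, hI, ⟨e⟩⟩ := isSimpleModule_iff_quot_maximal.1 this
  obtain rfl := eq_maximalIdeal hI
  refine ⟨(e.symm (Ideal.Quotient.mk _ 1) : A), ?_, ?_⟩
  · intro h
    have h1 := (LinearEquiv.map_eq_zero_iff e.symm).1 (Subtype.ext h)
    rw [Ideal.Quotient.eq_zero_iff_mem] at h1
    exact (Ideal.ne_top_iff_one _).1 hI.ne_top h1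
  · intro r hr
    rw [← Submodule.coe_smul, ← map_smul]
    have : r • (Ideal.Quotient.mk (maximalIdeal R)) 1 = 0 := residueField_smul_eq_zero hr _
    rw [this, map_zero, Submodule.coe_zero]

theorem exists_surjective_residueField [Module.Finite R V] [Nontrivial V] :
    ∃ f : V →ₗ[R] ResidueField R, Function.Surjective f := by
  obtain ⟨N, hN, -⟩ := (eq_top_or_exists_le_coatom (⊥ : Submodule R V)).resolve_left bot_ne_top
  have : IsSimpleModule R (V ⧸ N) := isSimpleModule_iff_isCoatom.2 hN
  obtain ⟨I, hI, ⟨e⟩⟩ := isSimpleModule_iff_quot_maximal.1 this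
  obtain rfl := eq_maximalIdeal hI
  exact ⟨e.toLinearMap ∘ₗ N.mkQ, e.surjective.comp N.mkQ_surjective⟩

end

section ExtResidueField

variable {R : Type u} [CommRing R] [IsLocalRing R]

/-- Dévissage along a composition series, each of whose factors is the residue field. -/
theorem extVanish_of_isFiniteLength {N X : Type u} [AddCommGroup N] [Module R N]
    [AddCommGroup X] [Module R X] {i : ℕ} (hX : ExtVanish R (ResidueField R) X i)
    (hN : IsFiniteLength R N) : ExtVanish R N X i := by
  induction hN with
  | @of_subsingleton N _ _ _ =>
    exact hX.of_retract_left 0 0 (Subsingleton.elim _ _)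
  | @of_simple_quotient N _ _ S hS _ ih =>
    obtain ⟨I, hI, ⟨e⟩⟩ := isSimpleModule_iff_quot_maximal.1 hS
    obtain rfl := eq_maximalIdeal hI
    exact ExtVanish.of_exact S.subtype_injective S.mkQ_surjective
      (LinearMap.exact_subtype_mkQ S) ih ((ExtVanish.congr_left e).2 hX)

variable {M : Type u} [AddCommGroup M] [Module R M]

/-- The image of 1 would be killed by v, which is regular on M. -/
theorem extVanish_residueField_zero {v : R} (hv : v ∈ maximalIdeal R) (hreg : IsSMulRegular M v) :
    ExtVanish R (ResidueField R) M 0 := by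
  have : Subsingleton (ResidueField R →ₗ[R] M) := by
    refine ⟨fun f g => residueField_hom_ext (hreg ?_)⟩
    change v • f 1 = v • g 1
    rw [← map_smul, ← map_smul, residueField_smul_eq_zero hv, map_zero, map_zero]
  exact (Abelian.Ext.addEquiv₀.trans ModuleCat.homAddEquiv).subsingleton

open Abelian in
/-- If `v` is a regular element on `M` then `Hom(k, M / v M) ≅ Ext^1(k, M)`. -/
theorem nonempty_hom_quotSMulTop_equiv_ext {v : R} (hv : v ∈ maximalIdeal R)
    (hreg : IsSMulRegular M v) :
    Nonempty ((ResidueField R →ₗ[R] QuotSMulTop v M) ≃ₗ[R]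
      Ext (ModuleCat.of R (ResidueField R)) (ModuleCat.of R M) 1) := by
  have hS := IsSMulRegular.smulShortComplex_shortExact (M := ModuleCat.of R M) hreg
  let κ := ModuleCat.of R (ResidueField R)
  let δ : Ext κ (ModuleCat.of R (QuotSMulTop v M)) 0 →ₗ[R] Ext κ (ModuleCat.of R M) 1 :=
    Ext.postcompOfLinear hS.extClass R κ (zero_add 1)
  have h0 := extVanish_residueField_zero hv hreg
  have hδ : Function.Bijective δ := by
    constructor
    · rw [injective_iff_map_eq_zero]
      intro x hx
      obtain ⟨y, rfl⟩ := Ext.covariant_sequence_exact₃ κ hS x (zero_add 1) hx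
      have hy : y = 0 := h0.elim y 0
      rw [hy]
      exact Ext.zero_comp _ _ (Ext.mk₀ ((ModuleCat.of R M).smulShortComplex v).g) _ _
    · intro x
      obtain ⟨y, hy⟩ := Ext.covariant_sequence_exact₁ κ hS x (by
        change x.comp (Ext.mk₀ (v • 𝟙 (ModuleCat.of R M))) _ = 0
        -- Multiplication by v on Ext^1(k, M) can be computed on k, where it is zero. So every class
        -- is killed by v : M → M and comes from the connecting map.
        have hvk : v • 𝟙 κ = 0 := by
          ext y
          exact residueField_smul_eq_zero hv y
        have hsm : v • x = 0 := by
          have := congrArg (fun f => (Ext.mk₀ f).comp x (zero_add 1)) hvk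
          simpa [Ext.mk₀_smul] using this
        rw [Ext.mk₀_smul, Ext.comp_smul, Ext.comp_mk₀_id, hsm]) (zero_add 1)
      exact ⟨y, hy⟩
  exact ⟨(ModuleCat.homLinearEquiv (S := R) (M := κ)
    (N := ModuleCat.of R (QuotSMulTop v M))).symm ≪≫ₗ (Ext.linearEquiv₀ (R := R)).symm ≪≫ₗ
    LinearEquiv.ofBijective δ hδ⟩

/-- Over a one-dimensional local ring, a finitely generated module of positive depth is canonical
if and only if its type is one and the higher `Ext` groups from the residue field vanish. -/
theorem isCanonicalModule_iff (hdim : ringKrullDim R = 1) [Module.Finite R M] {v : R}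
    (hv : v ∈ maximalIdeal R) (hreg : IsSMulRegular M v) :
    IsCanonicalModule R M ↔ (∀ i, 2 ≤ i → ExtVanish R (ResidueField R) M i) ∧
      HasSimpleSocle R (QuotSMulTop v M) := by
  have hcast : ∀ i : ℕ, (i : WithBot ℕ∞) = 1 ↔ i = 1 := fun i => by norm_cast
  obtain ⟨e⟩ := nonempty_hom_quotSMulTop_equiv_ext hv hreg
  rw [hasSimpleSocle_iff]
  constructor
  · intro h
    refine ⟨fun i hi => h.ext_eq_zero i ?_, ?_⟩
    · rw [hdim, ne_eq, hcast]; lia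
    · obtain ⟨e'⟩ := h.ext_dim 1 (by rw [hdim, hcast])
      exact ⟨e ≪≫ₗ e'⟩
  · rintro ⟨h, ⟨e'⟩⟩
    refine ⟨inferInstance, fun i hi => ?_, fun i hi => ?_⟩
    · rw [hdim, ne_eq, hcast] at hi
      rcases Nat.lt_or_ge i 2 with h2 | h2
      · obtain rfl : i = 0 := by lia
        exact extVanish_residueField_zero hv hreg
      · exact h i h2
    · rw [hdim, hcast] at hi
      subst hi
      exact ⟨e.symm ≪≫ₗ e'⟩

end ExtResidueField

section FiniteOverDVR

variable {L : Type*} [CommRing L] [IsDomain L] [IsDiscreteValuationRing L] {ϖ : L}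
  (hϖ : Irreducible ϖ)

include hϖ in
-- Such a module is a finite-dimensional vector space over the field L/ϖ.
theorem isArtinian_of_smul_eq_zero {N : Type*} [AddCommGroup N] [Module L N] [Module.Finite L N]
    (hN : ∀ x : N, ϖ • x = 0) : IsArtinian L N := by
  have hmax : (Ideal.span {ϖ}).IsMaximal := by
    rw [← hϖ.maximalIdeal_eq]; exact maximalIdeal.isMaximal L
  have htors : Module.IsTorsionBySet L N (Ideal.span {ϖ} : Ideal L) := by
    rw [Module.isTorsionBySet_span_singleton_iff]
    exact fun x => hN x
  let := htors.module
  let := Ideal.Quotient.field (Ideal.span {ϖ})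
  have : IsScalarTower L (L ⧸ Ideal.span {ϖ}) N := htors.isScalarTower
  have : Module.Finite (L ⧸ Ideal.span {ϖ}) N := Module.Finite.of_restrictScalars_finite L _ _
  exact isArtinian_of_surjective_algebraMap (R := L ⧸ Ideal.span {ϖ}) Ideal.Quotient.mk_surjective

variable {R : Type*} [CommRing R] [Algebra L R]

variable (L) in
-- Integrality transfers both bounds: R is not a field because L is not, and a nonzero prime of R
-- contracts to a nonzero prime of L, which is maximal.
theorem ringKrullDim_eq_one_of_finite [IsDomain R] [Module.Finite L R]
    [FaithfulSMul L R] : ringKrullDim R = 1 := by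
  have hint : Algebra.IsIntegral L R := inferInstance
  have : ¬ ringKrullDim R ≤ 0 := fun h => by
    have : Ring.KrullDimLE 0 R := Ring.krullDimLE_iff.mpr h
    have hf : IsField R := Ring.KrullDimLE.isField_of_isDomain
    exact IsDiscreteValuationRing.not_isField L
      (isField_of_isIntegral_of_isField (FaithfulSMul.algebraMap_injective L R) hf)
  have h1 : Ring.KrullDimLE 1 R := Ring.KrullDimLE.mk₁' fun I hI hp => by
    have h2 : I.comap (algebraMap L R) ≠ ⊥ := by
      obtain ⟨x, hx, hx0⟩ := Submodule.exists_mem_ne_zero_of_ne_bot hI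
      exact Ideal.comap_ne_bot_of_integral_mem hx0 hx (hint.isIntegral x)
    have h3 : (I.comap (algebraMap L R)).IsMaximal :=
      IsPrime.to_maximal_ideal h2
    exact Ideal.isMaximal_of_isIntegral_of_isMaximal_comap I h3
  rw [Ring.krullDimLE_iff] at h1
  exact le_antisymm h1 (Order.succ_le_of_lt (lt_of_not_ge this))

end FiniteOverDVR

end LocalRing

/-! ### Semidualizing modules over finite algebras over a discrete valuation ring -/

section Semidualizing

open IsLocalRing

variable {R : Type u} [CommRing R] {C : Type u} [AddCommGroup C] [Module R C]

theorem IsSemidualizing.nontrivial [Nontrivial R] (h : IsSemidualizing R C) : Nontrivial C := by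
  by_contra hC
  rw [not_nontrivial_iff_subsingleton] at hC
  exact one_ne_zero (h.homothety.1 (Subsingleton.elim (LinearMap.lsmul R C 1)
    (LinearMap.lsmul R C 0)))

theorem IsSemidualizing.self : IsSemidualizing R R where
  finite := inferInstance
  homothety := by
    refine ⟨fun r s h => ?_, fun f => ⟨f 1, ?_⟩⟩
    · simpa using LinearMap.congr_fun h 1
    · ext
      simp
  ext_eq_zero i hi := ExtVanish.of_projective hi

/-- If C has rank n, then Hom(C, C) has rank n², and the homothety isomorphism forces n² = 1. -/
theorem IsSemidualizing.nonempty_equiv_of_free [Nontrivial R] (h : IsSemidualizing R C)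
    [Module.Free R C] : Nonempty (C ≃ₗ[R] R) := by
  have := h.finite
  have h1 : Module.finrank R (C →ₗ[R] C) = 1 := by
    rw [← (LinearEquiv.ofBijective _ h.homothety).finrank_eq, Module.finrank_self]
  rw [Module.finrank_linearMap] at h1
  exact ⟨LinearEquiv.ofFinrankEq _ _ (by rw [Nat.eq_one_of_mul_eq_one_left h1, Module.finrank_self])⟩

section

variable {L : Type*} [CommRing L] [IsDomain L] [IsDiscreteValuationRing L] {ϖ : L}
  (hϖ : Irreducible ϖ) [Algebra L R] [Module L C] [IsScalarTower L R C] [Module.Finite L R]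

include hϖ in
theorem isTorsionFree_of_isSMulRegular {N : Type*} [AddCommGroup N] [Module L N]
    (hN : IsSMulRegular N ϖ) : Module.IsTorsionFree L N := by
  refine ⟨fun r hr => ?_⟩
  obtain ⟨n, c, rfl⟩ := IsDiscreteValuationRing.eq_unit_mul_pow_irreducible hr.ne_zero hϖ
  exact (IsUnit.isSMulRegular N c.isUnit).mul (hN.pow n)

include hϖ in
-- If the ϖ-torsion T were nonzero, it would contain a socle element, and C → k → T ⊆ C would be a
-- nonzero endomorphism killed by ϖ. It is multiplication by some r with ϖ r = 0, and r = 0 in a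
-- domain.
theorem IsSemidualizing.isSMulRegular [IsLocalRing R] [IsDomain R] [FaithfulSMul L R]
    (h : IsSemidualizing R C) : IsSMulRegular C ϖ := by
  have := h.finite
  have := h.nontrivial
  have : Module.Finite L C := Module.Finite.trans R C
  let T : Submodule R C := LinearMap.ker (LinearMap.lsmul R C (algebraMap L R ϖ))
  have hT : ∀ x : T, ϖ • x = 0 := fun x => by
    have := x.2
    simp only [T, LinearMap.mem_ker, LinearMap.lsmul_apply, algebraMap_smul] at this
    exact Subtype.ext this
  have : Module.Finite L T :=
    Module.Finite.of_injective (T.subtype.restrictScalars L) T.subtype_injective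
  have := isArtinian_of_smul_eq_zero hϖ hT
  have : IsArtinian R T := isArtinian_of_tower L this
  have hT0 : Subsingleton T := by
    rw [← not_nontrivial_iff_subsingleton]
    intro hnt
    obtain ⟨s, hs0, hs⟩ := exists_socle_ne_zero (R := R) (V := T)
    obtain ⟨f, hf⟩ := exists_surjective_residueField (R := R) (V := C)
    obtain ⟨r, hr⟩ := h.homothety.2 (T.subtype ∘ₗ residueFieldLift s hs ∘ₗ f)
    have hr0 : algebraMap L R ϖ * r = 0 := by
      apply h.homothety.1
      rw [map_zero, ← smul_eq_mul, map_smul, hr]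
      ext x
      have := hT (residueFieldLift s hs (f x))
      simpa using congrArg Subtype.val this
    have h2 : r = 0 := (mul_eq_zero.1 hr0).resolve_left fun h0 => hϖ.ne_zero
      ((FaithfulSMul.algebraMap_injective L R) (h0.trans (map_zero _).symm))
    obtain ⟨x, hx⟩ := hf 1
    have h3 := LinearMap.congr_fun hr x
    rw [h2, map_zero] at h3
    apply hs0
    apply Subtype.ext
    have h4 : residueFieldLift s hs 1 = s := by
      rw [← map_one (residue R), residueFieldLift_residue, one_smul]
    simpa [hx, h4] using h3.symm
  refine fun x y hxy => ?_
  have hxy' : x - y ∈ T := by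
    simp only [T, LinearMap.mem_ker, LinearMap.lsmul_apply, algebraMap_smul, smul_sub]
    exact sub_eq_zero.2 hxy
  have := congrArg Subtype.val (hT0.elim ⟨x - y, hxy'⟩ 0)
  exact sub_eq_zero.1 this

include hϖ in
theorem IsSemidualizing.free_of_dvr [IsLocalRing R] [IsDomain R] [FaithfulSMul L R]
    (h : IsSemidualizing R C) : Module.Free L C := by
  have := h.finite
  have : Module.Finite L C := Module.Finite.trans R C
  have := isTorsionFree_of_isSMulRegular hϖ (h.isSMulRegular hϖ)
  infer_instance

end

/-- A semidualizing module is torsion-free here, hence free, hence of rank one. This disposes of the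
factor k[[t]] in the degenerate gluings. -/
theorem not_hasNontrivialSemidualizing_of_dvr [IsDomain R] [IsDiscreteValuationRing R] :
    ¬ HasNontrivialSemidualizing R := by
  rintro ⟨D, _, _, h⟩
  obtain ⟨ϖ, hϖ⟩ := IsDiscreteValuationRing.exists_irreducible R
  have := h.semidualizing.free_of_dvr hϖ
  exact h.not_free h.semidualizing.nonempty_equiv_of_free

end Semidualizing

/-! ### Tensor products over L: the glued module is semidualizing -/

section TensorCoord

open TensorProduct

variable {L R₁ M₁ M₂ M : Type*} [CommRing L] [CommRing R₁] [Algebra L R₁]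
  [AddCommGroup M₁] [Module L M₁] [Module R₁ M₁] [IsScalarTower L R₁ M₁]
  [AddCommGroup M₂] [Module L M₂]
  [AddCommGroup M] [Module L M] [Module R₁ M] [IsScalarTower L R₁ M]
  {β : M₁ →ₗ[L] M₂ →ₗ[L] M} (hβ : IsTensorProduct β)
  (h₁ : ∀ (r : R₁) x y, β (r • x) y = r • β x y)
  {ι : Type*} [Fintype ι] [DecidableEq ι] (b : Module.Basis ι L M₂)

/-- The tensor product `M = M₁ ⊗ M₂` is a direct sum of copies of `M₁`, if `M₂` is free. -/
noncomputable def tensorCoord : M ≃ₗ[R₁] (ι → M₁) :=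
  (({ hβ.equiv with
      map_smul' := fun r z => by
        induction z using TensorProduct.induction_on with
        | zero => simp
        | tmul x y => simpa [TensorProduct.smul_tmul'] using h₁ r x y
        | add z w hz hw =>
          simp only [smul_add, map_add, AddHom.toFun_eq_coe,
            LinearMap.coe_toAddHom, LinearEquiv.coe_coe] at hz hw ⊢
          rw [hz, hw] } : M₁ ⊗[L] M₂ ≃ₗ[R₁] M).symm) ≪≫ₗ
    (AlgebraTensorModule.congr (LinearEquiv.refl R₁ M₁) b.equivFun) ≪≫ₗ
    TensorProduct.piScalarRight L R₁ M₁ ι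

@[simp]
theorem tensorCoord_apply (x : M₁) (y : M₂) :
    tensorCoord hβ h₁ b (β x y) = fun i => b.repr y i • x := by
  have : hβ.equiv.symm (β x y) = x ⊗ₜ y := by
    rw [LinearEquiv.symm_apply_eq]; rfl
  have h2 : tensorCoord hβ h₁ b (β x y) = TensorProduct.piScalarRight L R₁ M₁ ι
      (AlgebraTensorModule.congr (LinearEquiv.refl R₁ M₁) b.equivFun
        (hβ.equiv.symm (β x y))) := rfl
  rw [h2, this]
  ext i
  simp

end TensorCoord

section Glue

open TensorProduct IsLocalRing

variable {L R₁ R₂ R M₁ M₂ M : Type u}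
  [CommRing L] [CommRing R₁] [CommRing R₂] [CommRing R] [Algebra L R₁] [Algebra L R₂] [Algebra L R]
  [Algebra R₁ R] [Algebra R₂ R] [IsScalarTower L R₁ R] [IsScalarTower L R₂ R]
  [AddCommGroup M₁] [Module L M₁] [Module R₁ M₁] [IsScalarTower L R₁ M₁]
  [AddCommGroup M₂] [Module L M₂] [Module R₂ M₂] [IsScalarTower L R₂ M₂]
  [AddCommGroup M] [Module L M] [Module R₁ M] [Module R₂ M] [Module R M]
  [IsScalarTower L R M] [IsScalarTower R₁ R M] [IsScalarTower R₂ R M]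
  [IsScalarTower L R₁ M] [IsScalarTower L R₂ M] [SMulCommClass R₁ R₂ M]
  {β : M₁ →ₗ[L] M₂ →ₗ[L] M} (hβ : IsTensorProduct β)
  (h₁ : ∀ (r : R₁) x y, β (r • x) y = r • β x y)
  (h₂ : ∀ (r : R₂) x y, β x (r • y) = r • β x y)

/-- The map `M₂ ⊗ R₁ → Hom_{R₁}(M₁, M₁ ⊗ M₂)`. -/
noncomputable def tensorToHom : M₂ ⊗[L] R₁ →ₗ[R₂] (M₁ →ₗ[R₁] M) :=
  AlgebraTensorModule.lift
    { toFun := fun y =>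
        { toFun := fun r =>
            { toFun := fun x => β (r • x) y
              map_add' := by simp
              map_smul' := fun s x => by
                rw [smul_comm, h₁, RingHom.id_apply] }
          map_add' := fun r s => by ext; simp [add_smul]
          map_smul' := fun c r => by ext; simp }
      map_add' := fun y z => by ext; simp
      map_smul' := fun s y => by ext; simp [h₂] }

@[simp]
theorem tensorToHom_tmul (y : M₂) (r : R₁) (x : M₁) :
    tensorToHom h₁ h₂ (y ⊗ₜ r) x = β (r • x) y := rfl

include hβ in
-- In terms of an L-basis of M₂, both sides are powers, of R₁ and of Hom(M₁, M₁), and in each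
-- coordinate the map is the homothety of M₁.
theorem bijective_tensorToHom [Module.Finite L M₂] [Module.Free L M₂]
    (hM₁ : Function.Bijective (LinearMap.lsmul R₁ M₁)) :
    Function.Bijective (tensorToHom h₁ h₂ : M₂ ⊗[L] R₁ →ₗ[R₂] (M₁ →ₗ[R₁] M)) := by
  classical
  let b := Module.Free.chooseBasis L M₂
  let B := (TensorProduct.comm L M₂ R₁) ≪≫ₗ (tensorCoord (R₁ := R₁)
    (TensorProduct.isTensorProduct L R₁ M₂) (fun _ _ _ => rfl) b).restrictScalars L
  have hB : ∀ y r, B (y ⊗ₜ r) = fun i => b.repr y i • r := fun y r =>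
    tensorCoord_apply (R₁ := R₁) (TensorProduct.isTensorProduct L R₁ M₂) (fun _ _ _ => rfl) b r y
  have key : ∀ z x i, tensorCoord hβ h₁ b (tensorToHom h₁ h₂ z x) i = B z i • x := by
    intro z x i
    induction z using TensorProduct.induction_on with
    | zero => simp
    | tmul y r => simp [hB]
    | add z w hz hw => simp [add_smul, hz, hw]
  constructor
  · rw [injective_iff_map_eq_zero]
    intro z hz
    have : B z = 0 := by
      ext i
      apply hM₁.1
      ext x
      simp [← key, hz]
    simpa using this
  · intro g
    have := fun i => hM₁.2 (LinearMap.proj i ∘ₗ (tensorCoord hβ h₁ b).toLinearMap ∘ₗ g)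
    choose r hr using this
    refine ⟨B.symm r, ?_⟩
    ext x
    apply (tensorCoord hβ h₁ b).injective
    ext i
    rw [key, LinearEquiv.apply_symm_apply]
    exact LinearMap.congr_fun (hr i) x

include hβ h₁ h₂ in
/-- The isomorphism `(R ⊗_{R₁} M₁) ⊗_{R₂} M₂ ≅ M`. -/
theorem exists_equiv_baseChange_tensor [Algebra.IsPushout L R₁ R₂ R] :
    Nonempty ((R ⊗[R₁] M₁) ⊗[R₂] M₂ ≃ₗ[R] M) := by
  have := SMulCommClass.symm R₁ R₂ M
  have : Algebra.IsPushout L R₂ R₁ R := Algebra.IsPushout.symm inferInstance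
  let β' : M₁ →ₗ[R₁] M₂ →ₗ[R₂] M :=
    { toFun := fun x =>
        { toFun := fun y => β x y
          map_add' := by simp
          map_smul' := fun r y => h₂ r x y }
      map_add' := fun x y => by ext; simp
      map_smul' := fun r x => by ext; simp [h₁] }
  let Θ : (R ⊗[R₁] M₁) ⊗[R₂] M₂ →ₗ[R] M :=
    AlgebraTensorModule.lift (β'.liftBaseChange R)
  -- M₁ ⊗_L M₂ ≅ (R₂ ⊗_L M₁) ⊗_{R₂} M₂ ≅ (R ⊗_{R₁} M₁) ⊗_{R₂} M₂ by cancelling base changes. It is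
  -- only needed additively: Θ is R-linear by construction and takes its bijectivity from here.
  let chain : M₁ ⊗[L] M₂ ≃+ (R ⊗[R₁] M₁) ⊗[R₂] M₂ :=
    (((TensorProduct.comm L M₁ M₂).toAddEquiv.trans
      (AlgebraTensorModule.cancelBaseChange L R₂ R₂ M₂ M₁).symm.toAddEquiv).trans
      (TensorProduct.comm R₂ M₂ (R₂ ⊗[L] M₁)).toAddEquiv).trans
      (LinearEquiv.rTensor M₂ (Algebra.IsPushout.cancelBaseChange L R₂ R₁ R M₁)).symm.toAddEquiv
  have hc : ∀ z, Θ (chain z) = hβ.equiv z := by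
    intro z
    induction z using TensorProduct.induction_on with
    | zero => simp
    | tmul x y =>
      simp [chain, Θ, β']
    | add z w hz hw => simp [hz, hw]
  refine ⟨LinearEquiv.ofBijective Θ ?_⟩
  have : Θ = hβ.equiv ∘ chain.symm := by
    ext z
    obtain ⟨w, rfl⟩ := chain.surjective z
    simp [hc]
  rw [this]
  exact hβ.equiv.bijective.comp chain.symm.bijective

theorem exists_eq_sum_mul [Algebra.IsPushout L R₁ R₂ R] {ι : Type*} [Fintype ι]
    (b : Module.Basis ι L R₁) (r : R) :
    ∃ s : ι → R₂, r = ∑ i, algebraMap R₁ R (b i) * algebraMap R₂ R (s i) := by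
  obtain ⟨z, rfl⟩ := (Algebra.IsPushout.equiv L R₁ R₂ R).surjective r
  induction z using TensorProduct.induction_on with
  | zero => exact ⟨0, by simp⟩
  | tmul x y =>
    refine ⟨fun i => b.repr x i • y, ?_⟩
    rw [Algebra.IsPushout.equiv_tmul]
    conv_lhs => rw [← b.sum_repr x, map_sum, Finset.sum_mul]
    refine Finset.sum_congr rfl fun i _ => ?_
    simp only [Algebra.smul_def, map_mul, ← IsScalarTower.algebraMap_apply]
    ring
  | add z w hz hw =>
    obtain ⟨s, hs⟩ := hz
    obtain ⟨t, ht⟩ := hw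
    refine ⟨s + t, ?_⟩
    rw [map_add, hs, ht, ← Finset.sum_add_distrib]
    exact Finset.sum_congr rfl fun i _ => by simp [mul_add]

variable [Nontrivial L] [Module.Finite L R₁] [Module.Free L R₁]
  [Module.Finite L R₂] [Module.Free L R₂]

include hβ h₁ h₂ in
-- Two changes of rings: from R₁ to R for P = R ⊗_{R₁} M₁, then from R₂ to R for M = P ⊗_{R₂} M₂.
theorem extVanish_of_isTensorProduct [IsNoetherianRing L] [Algebra.IsPushout L R₁ R₂ R]
    [Module.Free L M₁] [Module.Free L M₂]
    (hM₁ : IsSemidualizing R₁ M₁) (hM₂ : IsSemidualizing R₂ M₂) {i : ℕ} (hi : 0 < i) :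
    ExtVanish R M M i := by
  classical
  have : Algebra.IsPushout L R₂ R₁ R := Algebra.IsPushout.symm inferInstance
  have := hM₁.finite
  have := hM₂.finite
  have : IsNoetherianRing R₁ := .of_finite L R₁
  have : IsNoetherianRing R₂ := .of_finite L R₂
  have : Module.Finite L M₂ := Module.Finite.trans R₂ M₂
  obtain ⟨e⟩ := exists_equiv_baseChange_tensor (R := R) hβ h₁ h₂
  let eR := Algebra.IsPushout.equiv L R₁ R₂ R
  have : Module.Flat R₁ R := Module.Flat.of_linearEquiv eR.toLinearEquiv.symm
  have : Module.Flat R₂ (R ⊗[R₁] M₁) :=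
    Module.Flat.of_linearEquiv (Algebra.IsPushout.cancelBaseChange L R₂ R₁ R M₁)
  rw [← ExtVanish.congr_left (M := (R ⊗[R₁] M₁) ⊗[R₂] M₂) e]
  -- Ext_R(R ⊗_{R₁} M₁, M) is Ext_{R₁}(M₁, M), and M is a finite power of M₁ over R₁.
  have hP : ∀ i, 0 < i → ExtVanish R (R ⊗[R₁] M₁) M i := fun i hi => by
    rw [extVanish_tensor_iff (fun i hi => ExtVanish.of_projective hi)
      (LinearMap.ringLmapEquivSelf R R₁ M).symm hi]
    let b := Module.finBasis L M₂
    exact (ExtVanish.congr_right (tensorCoord hβ h₁ b)).2 (ExtVanish.pi_right (hM₁.ext_eq_zero i hi) _)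
  -- Hom_R(P, M) = Hom_{R₁}(M₁, M) = M₂ ⊗_L R₁, which is a finite power of M₂ over R₂.
  let E : M₂ ⊗[L] R₁ ≃ₗ[R₂] (R ⊗[R₁] M₁ →ₗ[R] M) :=
    LinearEquiv.ofBijective _ (bijective_tensorToHom hβ h₁ h₂ hM₁.homothety) ≪≫ₗ
      (LinearMap.liftBaseChangeEquiv R).restrictScalars R₂
  rw [extVanish_tensor_iff hP E hi]
  let b := Module.finBasis L R₁
  let eY : M₂ ⊗[L] R₁ ≃ₗ[R₂] (Fin _ → M₂) :=
    (AlgebraTensorModule.congr (LinearEquiv.refl R₂ M₂) b.equivFun) ≪≫ₗ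
      TensorProduct.piScalarRight L R₂ M₂ _
  exact (ExtVanish.congr_right eY).2 (ExtVanish.pi_right (hM₂.ext_eq_zero i hi) _)

include hβ h₁ h₂ in
-- An endomorphism g of M amounts to a map M₂ → Hom_{R₁}(M₁, M) ≅ M₂ ⊗_L R₁ ≅ M₂^n. Its components
-- are endomorphisms of M₂, hence homotheties by elements sᵢ of R₂, and g is multiplication by ∑ bᵢ
-- sᵢ, with bᵢ the chosen basis of R₁. Injectivity is read off in the same coordinates.
theorem bijective_lsmul_of_isTensorProduct [Algebra.IsPushout L R₁ R₂ R]
    [Module.Free L M₂] (hM₁ : IsSemidualizing R₁ M₁) (hM₂ : IsSemidualizing R₂ M₂) :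
    Function.Bijective (LinearMap.lsmul R M) := by
  classical
  have := hM₂.finite
  have : Module.Finite L M₂ := Module.Finite.trans R₂ M₂
  have hΓ := bijective_tensorToHom hβ h₁ h₂ hM₁.homothety
  let b := Module.finBasis L R₁
  let eY : M₂ ⊗[L] R₁ ≃ₗ[R₂] (Fin _ → M₂) :=
    (AlgebraTensorModule.congr (LinearEquiv.refl R₂ M₂) b.equivFun) ≪≫ₗ
      TensorProduct.piScalarRight L R₂ M₂ _
  have heY : ∀ y i, eY (y ⊗ₜ b i) = Pi.single i y := fun y i => by
    ext j
    simp [eY, Finsupp.single_apply, Pi.single_apply, eq_comm]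
  have heY' : ∀ f : Fin _ → M₂, eY (∑ i, f i ⊗ₜ b i) = f := fun f => by
    rw [map_sum]
    simp [heY, Finset.univ_sum_single]
  have hsmul : ∀ (s : Fin _ → R₂) x y,
      (∑ i, algebraMap R₁ R (b i) * algebraMap R₂ R (s i)) • β x y =
        tensorToHom h₁ h₂ (∑ i, (s i • y) ⊗ₜ b i) x := by
    intro s x y
    simp [Finset.sum_smul, mul_smul, algebraMap_smul, h₁, h₂]
  constructor
  · rw [injective_iff_map_eq_zero]
    intro r hr
    obtain ⟨s, rfl⟩ := exists_eq_sum_mul (R₂ := R₂) b r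
    have hs : ∀ i, s i = 0 := fun i => by
      apply hM₂.homothety.1
      ext y
      have h0 : tensorToHom h₁ h₂ (∑ i, (s i • y) ⊗ₜ b i) = 0 := by
        ext x
        rw [← hsmul]
        exact LinearMap.congr_fun hr _
      have h1 := (injective_iff_map_eq_zero _).1 hΓ.1 _ h0
      have h2 := congrFun (congrArg eY h1) i
      rw [heY' fun i => s i • y] at h2
      simpa using h2
    simp [hs]
  · intro g
    let g' : M₂ →ₗ[R₂] (M₁ →ₗ[R₁] M) :=
      { toFun := fun y =>
          { toFun := fun x => g (β x y)
            map_add' := by simp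
            map_smul' := fun r x => by
              rw [h₁, ← algebraMap_smul R r, map_smul, algebraMap_smul, RingHom.id_apply] }
        map_add' := fun y z => by ext; simp
        map_smul' := fun r y => by
          ext x
          change g (β x (r • y)) = r • g (β x y)
          rw [h₂, ← algebraMap_smul R r, map_smul, algebraMap_smul] }
    let G : M₂ →ₗ[R₂] (Fin _ → M₂) :=
      eY.toLinearMap ∘ₗ (LinearEquiv.ofBijective _ hΓ).symm.toLinearMap ∘ₗ g'
    choose s hs using fun i => hM₂.homothety.2 (LinearMap.proj i ∘ₗ G)
    refine ⟨∑ i, algebraMap R₁ R (b i) * algebraMap R₂ R (s i), ?_⟩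
    have hG : ∀ y, tensorToHom h₁ h₂ (∑ i, (s i • y) ⊗ₜ b i) = g' y := by
      intro y
      have h1 : G y = fun i => s i • y := by
        ext i
        exact (LinearMap.congr_fun (hs i) y).symm
      have h2 : (LinearEquiv.ofBijective _ hΓ).symm (g' y) = ∑ i, (s i • y) ⊗ₜ b i := by
        apply eY.injective
        rw [heY' fun i => s i • y, ← h1]
        rfl
      rw [← h2]
      exact (LinearEquiv.ofBijective _ hΓ).apply_symm_apply _
    ext m
    induction m using hβ.inductionOn with
    | zero => simp
    | tmul x y =>
      rw [LinearMap.lsmul_apply, hsmul, hG]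
      rfl
    | add m n hm hn => rw [map_add, map_add, hm, hn]

include hβ h₁ h₂ in
theorem IsSemidualizing.of_isTensorProduct [IsNoetherianRing L] [Algebra.IsPushout L R₁ R₂ R]
    [Module.Free L M₁] [Module.Free L M₂]
    (hM₁ : IsSemidualizing R₁ M₁) (hM₂ : IsSemidualizing R₂ M₂) : IsSemidualizing R M where
  finite := by
    have := hM₁.finite
    have := hM₂.finite
    have : Module.Finite L M₁ := Module.Finite.trans R₁ M₁
    have : Module.Finite L M₂ := Module.Finite.trans R₂ M₂
    have : Module.Finite L M := Module.Finite.equiv hβ.equiv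
    exact Module.Finite.of_restrictScalars_finite L R M
  homothety := bijective_lsmul_of_isTensorProduct hβ h₁ h₂ hM₁ hM₂
  ext_eq_zero _ hi := extVanish_of_isTensorProduct hβ h₁ h₂ hM₁ hM₂ hi

include hβ h₁ in
theorem exists_retract_of_isTensorProduct [Module.Finite L M₂] [Module.Free L M₂]
    [Nontrivial M₂] :
    ∃ (ι : M₁ →ₗ[R₁] M) (π : M →ₗ[R₁] M₁), π ∘ₗ ι = LinearMap.id := by
  classical
  let b := Module.Free.chooseBasis L M₂
  obtain ⟨j⟩ := b.index_nonempty
  refine ⟨(tensorCoord hβ h₁ b).symm.toLinearMap ∘ₗ LinearMap.single R₁ (fun _ => M₁) j,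
    LinearMap.proj j ∘ₗ (tensorCoord hβ h₁ b).toLinearMap, ?_⟩
  ext x
  simp

include hβ h₁ in
-- M ≅ R is free over R₁ and has M₁ as a direct summand; so M₁ is projective over a local ring,
-- hence free, hence of rank one.
theorem nonempty_equiv_of_isTensorProduct_equiv [IsLocalRing R₁] [Algebra.IsPushout L R₁ R₂ R]
    [Module.Finite L M₂] [Module.Free L M₂] [Nontrivial M₂] (hM₁ : IsSemidualizing R₁ M₁)
    (e : M ≃ₗ[R] R) : Nonempty (M₁ ≃ₗ[R₁] R₁) := by
  obtain ⟨ι, π, hπ⟩ := exists_retract_of_isTensorProduct hβ h₁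
  have := hM₁.finite
  have hfree : Module.Free R₁ R := Module.Free.of_equiv
    (Algebra.IsPushout.equiv L R₁ R₂ R).toLinearEquiv
  have : Module.Free R₁ M := Module.Free.of_equiv (e.restrictScalars R₁).symm
  have : Module.Projective R₁ M₁ := Module.Projective.of_split ι π hπ
  have : Module.Free R₁ M₁ := Module.free_of_flat_of_isLocalRing
  exact hM₁.nonempty_equiv_of_free

end Glue

/-! ### Socles modulo the uniformizer -/

section Socle

open IsLocalRing

theorem mk_quotSMulTop_eq_zero_iff {R M : Type*} [CommRing R] [AddCommGroup M] [Module R M]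
    {v : R} {x : M} :
    (Submodule.Quotient.mk x : QuotSMulTop v M) = 0 ↔ ∃ z, v • z = x := by
  rw [Submodule.Quotient.mk_eq_zero, Submodule.mem_smul_pointwise_iff_exists]
  simp

/-- Phrased with elements of M, the socle condition can be compared between M₁ over R₁ and M over R
without handling the quotients. -/
theorem hasSimpleSocle_quotSMulTop_iff {R M : Type*} [CommRing R] [IsLocalRing R]
    [AddCommGroup M] [Module R M] {v : R} :
    HasSimpleSocle R (QuotSMulTop v M) ↔ ∃ s : M, (¬ ∃ z, v • z = s) ∧
      (∀ r ∈ maximalIdeal R, ∃ z, v • z = r • s) ∧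
      ∀ x : M, (∀ r ∈ maximalIdeal R, ∃ z, v • z = r • x) → ∃ (r : R) (z : M),
        v • z = x - r • s := by
  constructor
  · rintro ⟨s, hs0, hs, hs'⟩
    obtain ⟨s, rfl⟩ := Submodule.Quotient.mk_surjective _ s
    refine ⟨s, fun h => hs0 (mk_quotSMulTop_eq_zero_iff.2 h),
      fun r hr => mk_quotSMulTop_eq_zero_iff.1 (hs r hr), fun x hx => ?_⟩
    obtain ⟨r, hr⟩ := hs' (Submodule.Quotient.mk x)
      fun r hr => mk_quotSMulTop_eq_zero_iff.2 (hx r hr)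
    refine ⟨r, mk_quotSMulTop_eq_zero_iff.1 ?_⟩
    rw [Submodule.Quotient.mk_sub, hr, Submodule.Quotient.mk_smul, sub_self]
  · rintro ⟨s, hs0, hs, hs'⟩
    refine ⟨Submodule.Quotient.mk s, fun h => hs0 (mk_quotSMulTop_eq_zero_iff.1 h),
      fun r hr => mk_quotSMulTop_eq_zero_iff.2 (hs r hr), fun x hx => ?_⟩
    obtain ⟨x, rfl⟩ := Submodule.Quotient.mk_surjective _ x
    obtain ⟨r, hr⟩ := hs' x fun r hr => mk_quotSMulTop_eq_zero_iff.1 (hx r hr)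
    refine ⟨r, ?_⟩
    have := mk_quotSMulTop_eq_zero_iff.2 hr
    rwa [Submodule.Quotient.mk_sub, sub_eq_zero] at this

open Pointwise in
/-- A nonzero module that is finite over a discrete valuation ring has an element that gives a
nonzero socle element modulo the uniformizer. -/
theorem exists_socle_mod_uniformizer {L R M : Type*} [CommRing L] [IsDomain L]
    [IsDiscreteValuationRing L] {ϖ : L} (hϖ : Irreducible ϖ) [CommRing R] [IsLocalRing R]
    [Algebra L R] [IsLocalHom (algebraMap L R)] [AddCommGroup M] [Module R M] [Module L M]
    [IsScalarTower L R M] [Module.Finite L M] [Nontrivial M] :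
    ∃ x : M, (¬ ∃ z, ϖ • z = x) ∧ ∀ r ∈ maximalIdeal R, ∃ z, ϖ • z = r • x := by
  have : Module.Finite R M := Module.Finite.of_restrictScalars_finite L R M
  let W : Submodule R M := algebraMap L R ϖ • ⊤
  let V := M ⧸ W
  have hV : ∀ x : V, ϖ • x = 0 := by
    intro x
    obtain ⟨x, rfl⟩ := Submodule.Quotient.mk_surjective _ x
    rw [← Submodule.Quotient.mk_smul, mk_quotSMulTop_eq_zero_iff]
    exact ⟨x, algebraMap_smul R ϖ x⟩
  have : Module.Finite L V :=
    Module.Finite.of_surjective (W.mkQ.restrictScalars L) W.mkQ_surjective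
  have := isArtinian_of_smul_eq_zero hϖ hV
  have : IsArtinian R V := isArtinian_of_tower L this
  have : Nontrivial V := by
    by_contra hV
    rw [not_nontrivial_iff_subsingleton] at hV
    -- V = 0 would mean M = ϖ M, and Nakayama's lemma would give M = 0.
    have hle : (⊤ : Submodule R M) ≤ Ideal.span {algebraMap L R ϖ} • ⊤ := by
      intro x _
      obtain ⟨z, rfl⟩ := mk_quotSMulTop_eq_zero_iff.1
        (hV.elim (Submodule.Quotient.mk x : V) 0)
      exact Submodule.smul_mem_smul (Ideal.mem_span_singleton_self _) trivial
    have hj : Ideal.span {algebraMap L R ϖ} ≤ Ideal.jacobson ⊥ := by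
      rw [jacobson_eq_maximalIdeal _ bot_ne_top, Ideal.span_singleton_le_iff_mem]
      exact (map_mem_nonunits_iff _ _).2 hϖ.not_isUnit
    exact top_ne_bot (Submodule.eq_bot_of_le_smul_of_le_jacobson_bot _ _
      Module.Finite.fg_top hle hj)
  obtain ⟨s, hs0, hs⟩ := exists_socle_ne_zero (R := R) (V := V)
  obtain ⟨s, rfl⟩ := Submodule.Quotient.mk_surjective _ s
  simp_rw [← algebraMap_smul R ϖ]
  exact ⟨s, fun h => hs0 (mk_quotSMulTop_eq_zero_iff.2 h),
    fun r hr => mk_quotSMulTop_eq_zero_iff.1 (hs r hr)⟩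

end Socle

/-! ### Descent of the canonical module, and nontriviality -/

section GlueLocal

open TensorProduct IsLocalRing

variable {L R₁ R₂ R M₁ M₂ M : Type u}
  [CommRing L] [IsDomain L] [IsDiscreteValuationRing L] {ϖ : L} (hϖ : Irreducible ϖ)
  [CommRing R₁] [CommRing R₂] [CommRing R] [Algebra L R₁] [Algebra L R₂] [Algebra L R]
  [Algebra R₁ R] [Algebra R₂ R] [IsScalarTower L R₁ R] [IsScalarTower L R₂ R]
  [Algebra.IsPushout L R₁ R₂ R]
  [Module.Finite L R₁] [Module.Free L R₁] [Module.Finite L R₂] [Module.Free L R₂]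
  [IsLocalRing R₁] [IsLocalRing R₂] [IsLocalRing R]
  [IsLocalHom (algebraMap L R₁)] [IsLocalHom (algebraMap L R₂)]
  [IsLocalHom (algebraMap R₁ R)] [IsLocalHom (algebraMap R₂ R)]
  (hres₁ : ∀ r : R₁, ∃ c : L, r - algebraMap L R₁ c ∈ maximalIdeal R₁)
  (hres₂ : ∀ r : R₂, ∃ c : L, r - algebraMap L R₂ c ∈ maximalIdeal R₂)

variable (R₁ R₂ R) in
/-- The ideal of `R = R₁ ⊗ R₂` that is generated by the maximal ideals of `R₁` and `R₂`. -/
noncomputable def glueIdeal : Ideal R :=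
  (maximalIdeal R₁).map (algebraMap R₁ R) ⊔ (maximalIdeal R₂).map (algebraMap R₂ R)

omit [IsLocalHom (algebraMap L R₁)] [IsLocalHom (algebraMap L R₂)] in
theorem glueIdeal_le : glueIdeal R₁ R₂ R ≤ maximalIdeal R :=
  sup_le (Ideal.map_le_iff_le_comap.2 fun x => (map_mem_nonunits_iff (algebraMap R₁ R) x).2)
    (Ideal.map_le_iff_le_comap.2 fun x => (map_mem_nonunits_iff (algebraMap R₂ R) x).2)

include hres₁ hres₂ in
-- R is generated by the images of R₁ and R₂, and each of these is L plus its maximal ideal.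
theorem exists_sub_mem_glueIdeal (r : R) : ∃ c : L, r - algebraMap L R c ∈ glueIdeal R₁ R₂ R := by
  let q : R →+* R ⧸ glueIdeal R₁ R₂ R := Ideal.Quotient.mk _
  let T := (q.comp (algebraMap L R)).range
  have h1 : ∀ x : R₁, q (algebraMap R₁ R x) ∈ T := fun x => by
    obtain ⟨c, hc⟩ := hres₁ x
    refine ⟨c, ((Ideal.Quotient.mk_eq_mk_iff_sub_mem _ _).2 ?_).symm⟩
    rw [IsScalarTower.algebraMap_apply L R₁ R, ← map_sub]
    exact Ideal.mem_sup_left (Ideal.mem_map_of_mem _ hc)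
  have h2 : ∀ x : R₂, q (algebraMap R₂ R x) ∈ T := fun x => by
    obtain ⟨c, hc⟩ := hres₂ x
    refine ⟨c, ((Ideal.Quotient.mk_eq_mk_iff_sub_mem _ _).2 ?_).symm⟩
    rw [IsScalarTower.algebraMap_apply L R₂ R, ← map_sub]
    exact Ideal.mem_sup_right (Ideal.mem_map_of_mem _ hc)
  have h3 : q r ∈ T := by
    obtain ⟨s, rfl⟩ := exists_eq_sum_mul (R₂ := R₂) (Module.finBasis L R₁) r
    rw [map_sum]
    refine T.sum_mem fun i _ => ?_
    rw [map_mul]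
    exact T.mul_mem (h1 _) (h2 _)
  obtain ⟨c, hc⟩ := h3
  exact ⟨c, (Ideal.Quotient.mk_eq_mk_iff_sub_mem _ _).1 hc.symm⟩

include hres₁ hres₂ hϖ in
-- Modulo the glue ideal an element r of the maximal ideal is some c from L. Then c is a nonunit in
-- R, hence in R₁, so its image already lies in the glue ideal.
theorem maximalIdeal_le_glueIdeal : maximalIdeal R ≤ glueIdeal R₁ R₂ R := by
  intro r hr
  obtain ⟨c, hc⟩ := exists_sub_mem_glueIdeal (R := R) hres₁ hres₂ r
  have h1 : algebraMap L R c ∈ maximalIdeal R := by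
    have := (maximalIdeal R).sub_mem hr (glueIdeal_le (R := R) hc)
    rwa [sub_sub_cancel] at this
  have h2 : algebraMap L R₁ c ∈ maximalIdeal R₁ := by
    rw [IsScalarTower.algebraMap_apply L R₁ R] at h1
    exact (map_mem_nonunits_iff (algebraMap R₁ R) _).1 h1
  have h3 : algebraMap L R c ∈ glueIdeal R₁ R₂ R := by
    rw [IsScalarTower.algebraMap_apply L R₁ R]
    exact Ideal.mem_sup_left (Ideal.mem_map_of_mem _ h2)
  have := (glueIdeal R₁ R₂ R).add_mem hc h3
  rwa [sub_add_cancel] at this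

variable
  [AddCommGroup M₁] [Module L M₁] [Module R₁ M₁] [IsScalarTower L R₁ M₁]
  [AddCommGroup M₂] [Module L M₂] [Module R₂ M₂] [IsScalarTower L R₂ M₂]
  [AddCommGroup M] [Module L M] [Module R₁ M] [Module R₂ M] [Module R M]
  [IsScalarTower L R M] [IsScalarTower R₁ R M] [IsScalarTower R₂ R M]
  [IsScalarTower L R₁ M] [IsScalarTower L R₂ M] [SMulCommClass R₁ R₂ M]
  {β : M₁ →ₗ[L] M₂ →ₗ[L] M} (hβ : IsTensorProduct β)
  (h₁ : ∀ (r : R₁) x y, β (r • x) y = r • β x y)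
  (h₂ : ∀ (r : R₂) x y, β x (r • y) = r • β x y)

include hϖ hres₁ hres₂ hβ h₁ h₂ in
-- For a nonzero socle element y of M₂/ϖM₂, the map x ↦ x ⊗ y embeds the socle of M₁/ϖM₁ into that
-- of M/ϖM. If the latter is one-dimensional, so is the former.
theorem hasSimpleSocle_of_isTensorProduct [Module.Finite L M₁] [Module.Finite L M₂]
    [Module.Free L M₂] [Nontrivial M₁] [Nontrivial M₂]
    (h : HasSimpleSocle R (QuotSMulTop (algebraMap L R ϖ) M)) :
    HasSimpleSocle R₁ (QuotSMulTop (algebraMap L R₁ ϖ) M₁) := by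
  classical
  obtain ⟨y, hy0, hy⟩ := exists_socle_mod_uniformizer (R := R₂) (M := M₂) hϖ
  obtain ⟨x₀, hx₀0, hx₀⟩ := exists_socle_mod_uniformizer (R := R₁) (M := M₁) hϖ
  -- The maximal ideal of R is generated by those of R₁ and R₂; the first acts on x and the second
  -- on y.
  have hsoc : ∀ x : M₁, (∀ r ∈ maximalIdeal R₁, ∃ z, ϖ • z = r • x) →
      ∀ r ∈ maximalIdeal R, ∃ z, ϖ • z = r • β x y := by
    intro x hx r hr
    have hr' := maximalIdeal_le_glueIdeal hϖ hres₁ hres₂ hr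
    let T : Submodule R M := Submodule.map (LinearMap.lsmul R M (algebraMap L R ϖ)) ⊤
    have hT : ∀ m, m ∈ T ↔ ∃ z, ϖ • z = m := fun m => by simp [T]
    let J : Ideal R := T.comap (LinearMap.toSpanSingleton R M (β x y))
    have hJ : glueIdeal R₁ R₂ R ≤ J := by
      refine sup_le (Ideal.map_le_iff_le_comap.2 fun s hs => ?_)
        (Ideal.map_le_iff_le_comap.2 fun s hs => ?_)
      · obtain ⟨z, hz⟩ := hx s hs
        change algebraMap R₁ R s • β x y ∈ T
        rw [hT, algebraMap_smul, ← h₁, ← hz]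
        exact ⟨β z y, by simp⟩
      · obtain ⟨z, hz⟩ := hy s hs
        change algebraMap R₂ R s • β x y ∈ T
        rw [hT, algebraMap_smul, ← h₂, ← hz]
        exact ⟨β x z, by simp⟩
    exact (hT _).1 (hJ hr')
  let b := Module.finBasis L M₂
  -- As y is not in ϖ M₂, one of its coordinates is a unit; that coordinate of x ⊗ y recovers x
  -- modulo ϖ, which gives `hinj`.
  obtain ⟨j, hj⟩ : ∃ j, IsUnit (b.repr y j) := by
    by_contra! hcon
    have : ∀ j, ∃ d, b.repr y j = ϖ * d := fun j => by
      have := (mem_maximalIdeal _).2 (hcon j)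
      rw [hϖ.maximalIdeal_eq, Ideal.mem_span_singleton] at this
      exact this
    choose d hd using this
    refine hy0 ⟨∑ j, d j • b j, ?_⟩
    conv_rhs => rw [← b.sum_repr y]
    rw [Finset.smul_sum]
    exact Finset.sum_congr rfl fun j _ => by rw [hd, mul_smul]
  have hinj : ∀ x : M₁, (∃ z, ϖ • z = β x y) → ∃ z, ϖ • z = x := by
    rintro x ⟨z, hz⟩
    have := congrFun (congrArg (tensorCoord hβ h₁ b) hz) j
    rw [tensorCoord_apply, ← algebraMap_smul R₁ ϖ, map_smul, Pi.smul_apply,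
      algebraMap_smul] at this
    obtain ⟨w, hw⟩ := hj
    refine ⟨(w⁻¹ : Lˣ) • tensorCoord hβ h₁ b z j, ?_⟩
    rw [smul_comm, this]
    change w⁻¹ • (b.repr y j • x) = x
    rw [← hw, Units.smul_def, smul_smul, Units.inv_mul, one_smul]
  rw [hasSimpleSocle_quotSMulTop_iff] at h ⊢
  simp only [algebraMap_smul] at h ⊢
  obtain ⟨s, hs0, hs, hs'⟩ := h
  refine ⟨x₀, hx₀0, hx₀, fun x hx => ?_⟩
  obtain ⟨r₀, z₀, hz₀⟩ := hs' _ (hsoc x₀ hx₀)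
  obtain ⟨r, z, hz⟩ := hs' _ (hsoc x hx)
  -- If r₀ were in the maximal ideal, r₀ s, and with it x₀ ⊗ y, would vanish modulo ϖ.
  have hr₀ : IsUnit r₀ := by
    by_contra hr₀
    obtain ⟨w, hw⟩ := hs r₀ ((mem_maximalIdeal _).2 hr₀)
    exact hx₀0 (hinj x₀ ⟨z₀ + w, by rw [smul_add, hz₀, hw, sub_add_cancel]⟩)
  obtain ⟨q, rfl⟩ := hr₀
  -- Modulo ϖ, x ⊗ y is r/r₀ times x₀ ⊗ y. The glue ideal kills x₀ ⊗ y, so r/r₀ can be replaced by a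
  -- scalar c from L, which can then be moved to M₁.
  obtain ⟨c, hc⟩ := exists_sub_mem_glueIdeal hres₁ hres₂ (r * ((q⁻¹ : Rˣ) : R))
  obtain ⟨w, hw⟩ := hsoc x₀ hx₀ _ (glueIdeal_le hc)
  refine ⟨algebraMap L R₁ c, ?_⟩
  rw [algebraMap_smul]
  refine hinj _ ⟨z - (r * ((q⁻¹ : Rˣ) : R)) • z₀ + w, ?_⟩
  rw [smul_add, smul_sub, smul_comm ϖ, hz₀, hz, hw, map_sub, map_smul, LinearMap.sub_apply,
    LinearMap.smul_apply, smul_sub, sub_smul, smul_smul (r * _), mul_assoc, Units.inv_mul,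
    mul_one, algebraMap_smul]
  abel

variable [IsDomain R₁] [IsDomain R]

include hϖ hres₁ hres₂ hβ h₁ h₂ in
-- By flat base change Ext_{R₁}^i(k, M) is Ext_R^i(R ⊗_{R₁} k, M). The module R ⊗_{R₁} k has finite
-- length, so this vanishes for i ≥ 2 by dévissage, and M₁ is a direct summand of M over R₁. The
-- type is handled by `hasSimpleSocle_of_isTensorProduct`.
theorem isCanonicalModule_of_isTensorProduct [Module.Finite R₁ M₁] [Module.Finite L M₂]
    [Module.Free L M₁] [Module.Free L M₂] [Nontrivial M₁] [Nontrivial M₂]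
    (h : IsCanonicalModule R M) : IsCanonicalModule R₁ M₁ := by
  have : Module.Finite L M₁ := Module.Finite.trans R₁ M₁
  have : Module.Finite L M := Module.Finite.equiv hβ.equiv
  have : Module.Free L M := Module.Free.of_equiv hβ.equiv
  have : Module.Finite R M := Module.Finite.of_restrictScalars_finite L R M
  let eR := (Algebra.IsPushout.equiv L R₁ R₂ R).toLinearEquiv
  have : Module.Flat R₁ R := Module.Flat.of_linearEquiv eR.symm
  have : Module.Finite R₁ R := Module.Finite.equiv eR
  have : Module.Free L R := Module.Free.of_equiv (eR.restrictScalars L)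
  have : Module.Finite L R := Module.Finite.trans R₁ R
  have hreg : ∀ (A N : Type u) [CommRing A] [Algebra L A] [AddCommGroup N] [Module L N]
      [Module A N] [IsScalarTower L A N] [Module.Free L N],
      IsSMulRegular N (algebraMap L A ϖ) := by
    intro A N _ _ _ _ _ _ _ x y hxy
    simp only [algebraMap_smul] at hxy
    exact smul_right_injective N hϖ.ne_zero hxy
  have hm₁ : algebraMap L R₁ ϖ ∈ maximalIdeal R₁ :=
    (map_mem_nonunits_iff _ _).2 hϖ.not_isUnit
  have hm : algebraMap L R ϖ ∈ maximalIdeal R := by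
    rw [IsScalarTower.algebraMap_apply L R₁ R]
    exact (map_mem_nonunits_iff (algebraMap R₁ R) _).2 hm₁
  have hR₁ := ringKrullDim_eq_one_of_finite L (R := R₁)
  have hR := ringKrullDim_eq_one_of_finite L (R := R)
  rw [isCanonicalModule_iff hR hm (hreg R M)] at h
  rw [isCanonicalModule_iff hR₁ hm₁ (hreg R₁ M₁)]
  refine ⟨fun i hi => ?_, hasSimpleSocle_of_isTensorProduct hϖ hres₁ hres₂ hβ h₁ h₂ h.2⟩
  obtain ⟨ι, π, hπ⟩ := exists_retract_of_isTensorProduct hβ h₁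
  refine ExtVanish.of_retract_right ?_ ι π hπ
  have : IsNoetherianRing R₁ := .of_finite L R₁
  have : IsNoetherianRing R := .of_finite L R
  rw [← extVanish_tensor_iff (P := R) (fun i hi => ExtVanish.of_projective hi)
      (LinearMap.ringLmapEquivSelf R R₁ M).symm (by lia)]
  refine extVanish_of_isFiniteLength (h.1 i hi) ?_
  rw [isFiniteLength_iff_isNoetherian_isArtinian]
  refine ⟨inferInstance, ?_⟩
  -- ϖ acts as zero on the residue field of R₁; this makes the base change Artinian, being finite
  -- over L.
  have hkill : ∀ z : R ⊗[R₁] ResidueField R₁, ϖ • z = 0 := by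
    intro z
    induction z using TensorProduct.induction_on with
    | zero => simp
    | tmul x y =>
      rw [smul_tmul', ← algebraMap_smul R₁ ϖ, smul_tmul, residueField_smul_eq_zero hm₁, tmul_zero]
    | add z w hz hw => rw [smul_add, hz, hw, add_zero]
  have : Module.Finite L (R ⊗[R₁] ResidueField R₁) := Module.Finite.trans R _
  exact isArtinian_of_tower L (isArtinian_of_smul_eq_zero hϖ hkill)

include hϖ hres₁ hres₂ hβ h₁ h₂ in
theorem IsNontrivialSemidualizing.of_isTensorProduct [IsDomain R₂]
    (hM₁ : IsNontrivialSemidualizing R₁ M₁) (hM₂ : IsSemidualizing R₂ M₂) :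
    IsNontrivialSemidualizing R M := by
  have := hM₁.semidualizing.free_of_dvr hϖ (L := L)
  have := hM₂.free_of_dvr hϖ (L := L)
  have := hM₁.semidualizing.nontrivial
  have := hM₂.nontrivial
  have := hM₁.semidualizing.finite
  have := hM₂.finite
  have : Module.Finite L M₂ := Module.Finite.trans R₂ M₂
  exact ⟨.of_isTensorProduct hβ h₁ h₂ hM₁.semidualizing hM₂,
    fun ⟨e⟩ => hM₁.not_free (nonempty_equiv_of_isTensorProduct_equiv (R₂ := R₂) hβ h₁ hM₁.semidualizing e),
    fun h => hM₁.not_canonical (isCanonicalModule_of_isTensorProduct hϖ hres₁ hres₂ hβ h₁ h₂ h)⟩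

end GlueLocal

/-! ### Semigroup rings, and the substitution t ↦ t^c -/

section SemigroupRingLemmas

variable {k : Type u} [Field k]

theorem isUnit_semigroupRing_iff {H : AddSubmonoid ℕ} {x : semigroupRing k H} :
    IsUnit x ↔ PowerSeries.constantCoeff (x : PowerSeries k) ≠ 0 := by
  constructor
  · intro h
    have := (h.map (semigroupRing k H).val).map (PowerSeries.constantCoeff (R := k))
    exact this.ne_zero
  · intro hx
    refine IsUnit.of_mul_eq_one
      (⟨(x : PowerSeries k)⁻¹, inv_mem_semigroupRing k H x.2⟩ : semigroupRing k H) ?_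
    exact Subtype.ext (PowerSeries.mul_inv_cancel _ hx)

/-- The substitution `t ↦ t ^ c`, as a map `k[[S]] → k[[T]]`. -/
noncomputable def semigroupExpand {S T : AddSubmonoid ℕ} (c : ℕ) (hc : c ≠ 0)
    (h : ∀ s ∈ S, c * s ∈ T) : semigroupRing k S →+* semigroupRing k T :=
  ((PowerSeries.expand c hc).toRingHom.comp (semigroupRing k S).val.toRingHom).codRestrict
    (semigroupRing k T) fun x n hn => by
      change PowerSeries.coeff n (PowerSeries.expand c hc (x : PowerSeries k)) ≠ 0 at hn
      rw [PowerSeries.coeff_expand] at hn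
      split_ifs at hn with hd
      · obtain ⟨m, rfl⟩ := hd
        rw [Nat.mul_div_cancel_left _ (Nat.pos_of_ne_zero hc)] at hn
        exact h m (x.2 m hn)
      · exact absurd rfl hn

@[simp]
theorem coe_semigroupExpand {S T : AddSubmonoid ℕ} (c : ℕ) (hc : c ≠ 0)
    (h : ∀ s ∈ S, c * s ∈ T) (x : semigroupRing k S) :
    (semigroupExpand c hc h x : PowerSeries k) = PowerSeries.expand c hc (x : PowerSeries k) :=
  rfl

theorem isLocalHom_semigroupExpand {S T : AddSubmonoid ℕ} (c : ℕ) (hc : c ≠ 0)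
    (h : ∀ s ∈ S, c * s ∈ T) :
    IsLocalHom (semigroupExpand c hc h : semigroupRing k S →+* semigroupRing k T) := by
  refine ⟨fun x hx => ?_⟩
  rw [isUnit_semigroupRing_iff] at hx ⊢
  rwa [coe_semigroupExpand, PowerSeries.constantCoeff_expand] at hx

theorem exists_sub_semigroupExpand_mem {S T : AddSubmonoid ℕ} (c : ℕ) (hc : c ≠ 0)
    (h : ∀ s ∈ S, c * s ∈ T) (x : semigroupRing k T) :
    ∃ y : semigroupRing k S, x - semigroupExpand c hc h y ∈
      IsLocalRing.maximalIdeal (semigroupRing k T) := by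
  refine ⟨algebraMap k _ (PowerSeries.constantCoeff (x : PowerSeries k)), ?_⟩
  rw [IsLocalRing.mem_maximalIdeal, mem_nonunits_iff, isUnit_semigroupRing_iff, not_not]
  simp

theorem semigroupExpand_comp {S T U : AddSubmonoid ℕ} (c d e : ℕ) (hc : c ≠ 0) (hd : d ≠ 0)
    (he : e ≠ 0) (h : ∀ s ∈ S, c * s ∈ T) (h' : ∀ s ∈ T, d * s ∈ U) (h'' : ∀ s ∈ S, e * s ∈ U)
    (hde : d * c = e) :
    (semigroupExpand d hd h').comp (semigroupExpand c hc h) =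
      (semigroupExpand e he h'' : semigroupRing k S →+* semigroupRing k U) := by
  subst hde
  ext x : 1
  exact Subtype.ext (PowerSeries.expand_mul d hd c hc (x : PowerSeries k)).symm

/-- The inclusion `k[[H]] ⊆ k((t))`. -/
noncomputable def toLaurent (H : AddSubmonoid ℕ) : semigroupRing k H →+* LaurentSeries k :=
  (HahnSeries.ofPowerSeries ℤ k).comp (semigroupRing k H).val.toRingHom

theorem toLaurent_injective (H : AddSubmonoid ℕ) :
    Function.Injective (toLaurent (k := k) H) :=
  HahnSeries.ofPowerSeries_injective.comp Subtype.val_injective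

theorem smul_laurent {H : AddSubmonoid ℕ} (x : semigroupRing k H) (f : LaurentSeries k) :
    x • f = toLaurent H x * f := by
  rw [Subalgebra.smul_def, Algebra.smul_def, LaurentSeries.coe_algebraMap]
  rfl

theorem coeff_toLaurent {H : AddSubmonoid ℕ} (x : semigroupRing k H) (n : ℤ) :
    (toLaurent H x).coeff n = if n < 0 then 0 else PowerSeries.coeff n.natAbs (x : PowerSeries k) :=
  PowerSeries.coeff_coe _ _

theorem exists_toLaurent_eq_iff {H : AddSubmonoid ℕ} {f : LaurentSeries k} :
    (∃ x, toLaurent H x = f) ↔ ∀ n, f.coeff n ≠ 0 → ∃ h ∈ H, n = (h : ℤ) := by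
  constructor
  · rintro ⟨x, rfl⟩ n hn
    rw [coeff_toLaurent] at hn
    split_ifs at hn with h
    · exact absurd rfl hn
    · exact ⟨n.natAbs, x.2 _ hn, by lia⟩
  · intro hf
    refine ⟨⟨PowerSeries.mk fun n => f.coeff n, fun n hn => ?_⟩, ?_⟩
    · rw [PowerSeries.coeff_mk] at hn
      obtain ⟨h, hh, heq⟩ := hf n hn
      rwa [Nat.cast_injective heq]
    · ext n
      rw [coeff_toLaurent, PowerSeries.coeff_mk]
      split_ifs with h
      · by_contra hne
        obtain ⟨m, -, rfl⟩ := hf n (Ne.symm hne)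
        lia
      · congr
        lia

/-- The substitution `t ↦ t ^ c` on Laurent series. -/
noncomputable def laurentExpand (c : ℕ) (hc : c ≠ 0) : LaurentSeries k →+* LaurentSeries k :=
  HahnSeries.embDomainRingHom (AddMonoidHom.mulLeft (c : ℤ))
    (fun x y h => mul_left_cancel₀ (Nat.cast_ne_zero.2 hc) h)
    (fun x y => mul_le_mul_iff_right₀ (by positivity))

theorem coeff_laurentExpand_mul (c : ℕ) (hc : c ≠ 0) (f : LaurentSeries k) (n : ℤ) :
    (laurentExpand c hc f).coeff (c * n) = f.coeff n :=
  HahnSeries.embDomain_coeff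

theorem coeff_laurentExpand_of_not_dvd (c : ℕ) (hc : c ≠ 0) (f : LaurentSeries k) {n : ℤ}
    (hn : ¬ (c : ℤ) ∣ n) : (laurentExpand c hc f).coeff n = 0 :=
  HahnSeries.embDomain_of_notMem_range fun ⟨m, hm⟩ => hn ⟨m, hm.symm⟩

theorem laurentExpand_monomialT (c : ℕ) (hc : c ≠ 0) (r : ℤ) :
    laurentExpand c hc (monomialT k r) = monomialT k (c * r) :=
  HahnSeries.embDomain_single

theorem laurentExpand_toLaurent {S T : AddSubmonoid ℕ} (c : ℕ) (hc : c ≠ 0)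
    (h : ∀ s ∈ S, c * s ∈ T) (x : semigroupRing k S) :
    laurentExpand c hc (toLaurent S x) = toLaurent T (semigroupExpand c hc h x) := by
  ext n
  by_cases hn : (c : ℤ) ∣ n
  · obtain ⟨m, rfl⟩ := hn
    rw [coeff_laurentExpand_mul, coeff_toLaurent, coeff_toLaurent, coe_semigroupExpand,
      Int.natAbs_mul, Int.natAbs_natCast, PowerSeries.coeff_expand_mul]
    have : (c : ℤ) * m < 0 ↔ m < 0 := by
      have : (0 : ℤ) < c := by positivity
      constructor
      · intro h; by_contra h'; push Not at h'; nlinarith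
      · intro h; nlinarith
    simp only [this]
  · rw [coeff_laurentExpand_of_not_dvd c hc _ hn, coeff_toLaurent, coe_semigroupExpand,
      PowerSeries.coeff_expand]
    rw [Int.natCast_dvd] at hn
    simp [hn]

theorem monomialT_mul (r s : ℤ) : monomialT k r * monomialT k s = monomialT k (r + s) := by
  simp [monomialT]

end SemigroupRingLemmas

/-! ### Apéry sets -/

section Apery

/-- The integers `w i` represent `E` modulo `c`: the set `E` is the disjoint union of the
progressions `w i + c ℕ`, which lie in distinct residue classes. -/
structure IsApery {ι : Type*} (c : ℕ) (E : Set ℤ) (w : ι → ℤ) : Prop where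
  mem_iff : ∀ n, n ∈ E ↔ ∃ i, ∃ m : ℕ, n = w i + c * m
  eq_of_dvd : ∀ i j, (c : ℤ) ∣ w i - w j → i = j

theorem IsApery.mem {ι : Type*} {c : ℕ} {E : Set ℤ} {w : ι → ℤ} (h : IsApery c E w) (i : ι) :
    w i ∈ E := (h.mem_iff _).2 ⟨i, 0, by simp⟩

/-- w i is the least element of E congruent to i: it exists because E is bounded below and meets
every class, and adding multiples of c to it fills the rest of the class. -/
theorem exists_isApery {c : ℕ} (hc : c ≠ 0) {E : Set ℤ} (hE : ∀ n ∈ E, n + c ∈ E)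
    (hb : ∃ N, ∀ n ∈ E, N ≤ n) (hres : ∀ i : ℤ, ∃ n ∈ E, (c : ℤ) ∣ n - i) :
    ∃ w : Fin c → ℤ, IsApery c E w := by
  classical
  obtain ⟨N, hN⟩ := hb
  have : ∀ i : Fin c, ∃ w : ℤ, (w ∈ E ∧ (c : ℤ) ∣ w - (i : ℕ)) ∧
      ∀ z : ℤ, (z ∈ E ∧ (c : ℤ) ∣ z - (i : ℕ)) → w ≤ z := fun i =>
    Int.exists_least_of_bdd ⟨N, fun z hz => hN z hz.1⟩ (hres _)
  choose w hw hmin using this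
  have hE' : ∀ (m : ℕ), ∀ n ∈ E, n + c * m ∈ E := by
    intro m
    induction m with
    | zero => simp
    | succ m ih =>
      intro n hn
      have := hE _ (ih n hn)
      push_cast
      rwa [mul_add, mul_one, ← add_assoc]
  refine ⟨w, fun n => ⟨fun hn => ?_, ?_⟩, fun i j hij => ?_⟩
  · have hc' : (0 : ℤ) < c := by positivity
    have h1 := Int.emod_nonneg n hc'.ne'
    have h2 := Int.emod_lt_of_pos n hc'
    let i : Fin c := ⟨(n % c).toNat, by lia⟩
    have hi : ((i : ℕ) : ℤ) = n % c := Int.toNat_of_nonneg h1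
    have hd : (c : ℤ) ∣ n - (i : ℕ) := by rw [hi]; exact Int.dvd_self_sub_emod
    have hle := hmin i n ⟨hn, hd⟩
    obtain ⟨q, hq⟩ := (Int.dvd_sub hd (hw i).2)
    have hq0 : 0 ≤ q := by
      have : 0 ≤ (c : ℤ) * q := by rw [← hq]; linarith
      exact nonneg_of_mul_nonneg_right this hc'
    refine ⟨i, q.toNat, ?_⟩
    rw [Int.toNat_of_nonneg hq0]
    linarith
  · rintro ⟨i, m, rfl⟩
    exact hE' m _ (hw i).1
  · have h1 := Int.dvd_sub (Int.dvd_sub hij (hw i).2) (dvd_neg.2 (hw j).2)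
    have h2 : (c : ℤ) ∣ (i : ℕ) - (j : ℕ) := by
      convert h1 using 1; ring
    have hi : ((i : ℕ) : ℤ) < c := by exact_mod_cast i.2
    have hj : ((j : ℕ) : ℤ) < c := by exact_mod_cast j.2
    have hi0 : (0 : ℤ) ≤ ((i : ℕ) : ℤ) := Int.natCast_nonneg _
    have hj0 : (0 : ℤ) ≤ ((j : ℕ) : ℤ) := Int.natCast_nonneg _
    have h3 := Int.eq_zero_of_abs_lt_dvd h2 (by rw [abs_lt]; constructor <;> linarith)
    exact Fin.ext (by lia)

/-- The set `b E₁ + a E₂`. -/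
def glueSet (a b : ℕ) (E₁ E₂ : Set ℤ) : Set ℤ :=
  {n | ∃ r ∈ E₁, ∃ s ∈ E₂, n = b * r + a * s}

/-- The Chinese remainder theorem: b w₁ + a w₂ determines b w₁ modulo a and a w₂ modulo b, hence
both indices, and steps a in the first factor and b in the second both become steps ab. -/
theorem IsApery.glue {ι₁ ι₂ : Type*} {a b : ℕ} (hab : Nat.Coprime a b)
    {E₁ E₂ : Set ℤ} {w₁ : ι₁ → ℤ} {w₂ : ι₂ → ℤ} (h₁ : IsApery a E₁ w₁) (h₂ : IsApery b E₂ w₂) :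
    IsApery (a * b) (glueSet a b E₁ E₂) (fun p : ι₁ × ι₂ => b * w₁ p.1 + a * w₂ p.2) := by
  have hcop : IsCoprime (a : ℤ) b := Nat.isCoprime_iff_coprime.2 hab
  refine ⟨fun n => ⟨?_, ?_⟩, ?_⟩
  · rintro ⟨r, hr, s, hs, rfl⟩
    obtain ⟨i, m, rfl⟩ := (h₁.mem_iff r).1 hr
    obtain ⟨j, m', rfl⟩ := (h₂.mem_iff s).1 hs
    refine ⟨(i, j), m + m', ?_⟩
    push_cast
    ring
  · rintro ⟨⟨i, j⟩, m, rfl⟩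
    refine ⟨_, (h₁.mem_iff _).2 ⟨i, m, rfl⟩, _, h₂.mem j, ?_⟩
    push_cast
    ring
  · rintro ⟨i, j⟩ ⟨i', j'⟩ ⟨q, hq⟩
    push_cast at hq
    have e1 : i = i' := h₁.eq_of_dvd _ _ (hcop.dvd_of_dvd_mul_left
      ⟨b * q - (w₂ j - w₂ j'), by linear_combination hq⟩)
    have e2 : j = j' := h₂.eq_of_dvd _ _ (hcop.symm.dvd_of_dvd_mul_left
      ⟨a * q - (w₁ i - w₁ i'), by linear_combination hq⟩)
    rw [e1, e2]

theorem IsNumericalSemigroup.exists_mem_dvd_sub {S : AddSubmonoid ℕ} (hS : IsNumericalSemigroup S)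
    {c : ℕ} (hc : c ≠ 0) (i : ℤ) : ∃ n ∈ S, (c : ℤ) ∣ n - i := by
  have h1 : Nat.setGcd (S : Set ℕ) = 1 := hS _ fun h hh => Nat.setGcd_dvd_of_mem hh
  obtain ⟨N, hN⟩ := Nat.exists_mem_closure_of_ge (S : Set ℕ)
  have hc' : (0 : ℤ) < c := by positivity
  have h2 := Int.emod_nonneg i hc'.ne'
  -- Since the gcd is 1, every integer from N on lies in S; adding c N reaches that range without
  -- changing the class.
  refine ⟨(i % c).toNat + c * N, ?_, ?_⟩
  · have := hN ((i % c).toNat + c * N) (by nlinarith [Nat.pos_of_ne_zero hc]) (by rw [h1]; exact one_dvd _)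
    rwa [AddSubmonoid.closure_eq] at this
  · push_cast
    rw [Int.toNat_of_nonneg h2]
    have := Int.dvd_self_sub_emod (x := i) (m := c)
    obtain ⟨q, hq⟩ := this
    exact ⟨N - q, by linear_combination -hq⟩

end Apery

/-- The family `e` is a basis of `M` for the action of `L` through `φ : L → R`. -/
def IsBasisAlong {L R M ι : Type*} [CommRing L] [CommRing R] [AddCommGroup M] [Module R M]
    [Fintype ι] (φ : L →+* R) (e : ι → M) : Prop :=
  Function.Bijective (fun c : ι → L => ∑ i, φ (c i) • e i)

/-! ### Monomial modules: their exponents and their bases over k[[t^c]] -/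

section MonomialModules

variable {k : Type u} [Field k] {ι : Type*} [Fintype ι] {c : ℕ} (hc : c ≠ 0)
  {E : Set ℤ} {w : ι → ℤ} (hw : IsApery c E w) {H : AddSubmonoid ℕ}
  (hcH : ∀ s ∈ (⊤ : AddSubmonoid ℕ), c * s ∈ H)

include hw in
-- The summands are supported in distinct residue classes modulo c, so only the j-th one
-- contributes.
theorem coeff_sum_expand_mul_monomialT (f : ι → semigroupRing k ⊤) (j : ι) (m : ℕ) :
    (∑ i, toLaurent H (semigroupExpand c hc hcH (f i)) * monomialT k (w i)).coeff (w j + c * m) =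
      PowerSeries.coeff m (f j : PowerSeries k) := by
  have hc' : (0 : ℤ) < c := by positivity
  rw [HahnSeries.coeff_sum, Finset.sum_eq_single j]
  · rw [monomialT, HahnSeries.coeff_mul_single, mul_one, coeff_toLaurent, if_neg (by
      have : (0 : ℤ) ≤ c * m := by positivity
      lia), coe_semigroupExpand]
    have : (w j + c * m - w j).natAbs = c * m := by
      rw [add_sub_cancel_left, Int.natAbs_mul, Int.natAbs_natCast, Int.natAbs_natCast]
    rw [this, PowerSeries.coeff_expand_mul]
  · intro i _ hij
    rw [monomialT, HahnSeries.coeff_mul_single, mul_one, coeff_toLaurent, coe_semigroupExpand,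
      PowerSeries.coeff_expand, if_neg (c := c ∣ _), ite_self]
    intro hd
    apply hij
    rw [← Int.natCast_dvd] at hd
    obtain ⟨q, hq⟩ := hd
    exact hw.eq_of_dvd _ _ ⟨m - q, by linear_combination -hq⟩
  · simp

include hw in
theorem mem_of_coeff_sum_expand_mul_ne_zero (f : ι → semigroupRing k ⊤) (n : ℤ)
    (hn : (∑ i, toLaurent H (semigroupExpand c hc hcH (f i)) * monomialT k (w i)).coeff n ≠ 0) :
    n ∈ E := by
  rw [HahnSeries.coeff_sum] at hn
  obtain ⟨i, -, hi⟩ := Finset.exists_ne_zero_of_sum_ne_zero hn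
  rw [monomialT, HahnSeries.coeff_mul_single, mul_one, coeff_toLaurent, coe_semigroupExpand,
    PowerSeries.coeff_expand] at hi
  split_ifs at hi with h1 h2
  · exact absurd rfl hi
  · obtain ⟨q, hq⟩ := h2
    refine (hw.mem_iff n).2 ⟨i, q, ?_⟩
    have : ((n - w i).natAbs : ℤ) = c * q := by rw [hq]; push_cast; ring
    lia
  · exact absurd rfl hi

include hw in
theorem exists_eq_sum_expand_mul_monomialT {f : LaurentSeries k}
    (hf : ∀ n, f.coeff n ≠ 0 → n ∈ E) : ∃ g : ι → semigroupRing k ⊤,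
      f = ∑ i, toLaurent H (semigroupExpand c hc hcH (g i)) * monomialT k (w i) := by
  -- The i-th coefficient series reads f along the progression w i + c ℕ.
  refine ⟨fun i => ⟨PowerSeries.mk fun m => f.coeff (w i + c * m), fun _ _ => trivial⟩, ?_⟩
  ext n
  by_cases hn : n ∈ E
  · obtain ⟨j, m, rfl⟩ := (hw.mem_iff n).1 hn
    rw [coeff_sum_expand_mul_monomialT hc hw, PowerSeries.coeff_mk]
  · rw [not_imp_comm.1 (hf n) hn]
    by_contra h
    exact hn (mem_of_coeff_sum_expand_mul_ne_zero hc hw hcH _ n (Ne.symm h))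

include hw in
/-- A `k[[H]]`-module that embeds into `k((t))` as the set of series with support in `E` has a
basis of monomials over `k[[t ^ c]]`. -/
theorem isBasisAlong_semigroupExpand {N : Type*} [AddCommGroup N] [Module (semigroupRing k H) N]
    (γ : N →+ LaurentSeries k) (hγ : Function.Injective γ)
    (hsmul : ∀ (r : semigroupRing k H) x, γ (r • x) = toLaurent H r * γ x)
    (hrange : ∀ f, (∃ x, γ x = f) ↔ ∀ n, f.coeff n ≠ 0 → n ∈ E) (e : ι → N)
    (he : ∀ i, γ (e i) = monomialT k (w i)) :
    IsBasisAlong (semigroupExpand c hc hcH : semigroupRing k ⊤ →+* semigroupRing k H) e := by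
  have key : ∀ f : ι → semigroupRing k ⊤, γ (∑ i, semigroupExpand c hc hcH (f i) • e i) =
      ∑ i, toLaurent H (semigroupExpand c hc hcH (f i)) * monomialT k (w i) := fun f => by
    simp [hsmul, he]
  constructor
  · intro f g hfg
    have h1 := congrArg γ hfg
    simp only [key] at h1
    ext j : 1
    apply Subtype.ext
    ext m
    rw [← coeff_sum_expand_mul_monomialT hc hw hcH f j m, h1,
      coeff_sum_expand_mul_monomialT hc hw hcH g j m]
  · intro x
    obtain ⟨g, hg⟩ := exists_eq_sum_expand_mul_monomialT hc hw hcH ((hrange _).1 ⟨x, rfl⟩)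
    exact ⟨g, hγ ((key g).trans hg.symm)⟩

include hc hw hcH in
-- The algebraic span contains all series supported in E, although they have infinitely many terms:
-- each is a finite combination of the monomials t^(w i) with coefficients in k[[t^c]].
theorem mem_span_monomialT_iff {E₀ : Set ℤ} (h₀ : E₀ ⊆ E) (hE : ∀ n ∈ E, ∀ h ∈ H, n + (h : ℤ) ∈ E)
    (hwE₀ : ∀ i, monomialT k (w i) ∈ Submodule.span (semigroupRing k H) (monomialT k '' E₀))
    {f : LaurentSeries k} :
    f ∈ Submodule.span (semigroupRing k H) (monomialT k '' E₀) ↔ ∀ n, f.coeff n ≠ 0 → n ∈ E := by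
  constructor
  · intro hf
    induction hf using Submodule.span_induction with
    | mem x hx =>
      obtain ⟨r, hr, rfl⟩ := hx
      intro n hn
      by_cases hnr : n = r
      · rw [hnr]; exact h₀ hr
      · exact absurd (HahnSeries.coeff_single_of_ne hnr) hn
    | zero => simp
    | add x y _ _ hx hy =>
      intro n hn
      by_cases h : x.coeff n = 0
      · exact hy n fun h' => hn (by rw [HahnSeries.coeff_add, h, h', add_zero])
      · exact hx n h
    | smul r x _ hx =>
      intro n hn
      rw [smul_laurent, HahnSeries.coeff_mul] at hn
      obtain ⟨p, hp, hne⟩ := Finset.exists_ne_zero_of_sum_ne_zero hn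
      rw [Finset.mem_antidiagonal] at hp
      have h1 := hx _ (right_ne_zero_of_mul hne)
      obtain ⟨h, hh, hp1⟩ := exists_toLaurent_eq_iff.1 ⟨r, rfl⟩ _ (left_ne_zero_of_mul hne)
      rw [← hp.2.2, hp1, add_comm]
      exact hE _ h1 h hh
  · intro hf
    obtain ⟨g, rfl⟩ := exists_eq_sum_expand_mul_monomialT hc hw hcH hf
    refine Submodule.sum_mem _ fun i _ => ?_
    rw [← smul_laurent]
    exact Submodule.smul_mem _ _ (hwE₀ i)

theorem monomialT_mul_mem {I : Submodule (semigroupRing k H) (LaurentSeries k)} {r : ℤ}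
    (hr : monomialT k r ∈ I) {h : ℕ} (hh : h ∈ H) : monomialT k (r + h) ∈ I := by
  obtain ⟨x, hx⟩ := (exists_toLaurent_eq_iff (H := H) (f := monomialT k (h : ℤ))).2 fun n hn => by
    by_cases hnr : n = h
    · exact ⟨h, hh, hnr⟩
    · exact absurd (HahnSeries.coeff_single_of_ne hnr) hn
  rw [add_comm, ← monomialT_mul, ← hx, ← smul_laurent]
  exact I.smul_mem x hr

/-- Finitely many generators have a common lower bound for their exponents, and the ring only adds
nonnegative ones. -/
theorem exists_le_of_monomialT_mem {I : Submodule (semigroupRing k H) (LaurentSeries k)}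
    (hI : I.FG) : ∃ N : ℤ, ∀ r, monomialT k r ∈ I → N ≤ r := by
  classical
  obtain ⟨s, hs⟩ := hI
  have hbd : ∃ N : ℤ, ∀ f ∈ s, ∀ n < N, f.coeff n = 0 := by
    induction s using Finset.induction_on generalizing I with
    | empty => exact ⟨0, by simp⟩
    | insert f s _ ih =>
      obtain ⟨N, hN⟩ := ih rfl
      refine ⟨min N f.order, fun g hg n hn => ?_⟩
      rw [Finset.mem_insert] at hg
      rcases hg with rfl | hg
      · exact HahnSeries.coeff_eq_zero_of_lt_order (lt_of_lt_of_le hn (min_le_right _ _))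
      · exact hN g hg n (lt_of_lt_of_le hn (min_le_left _ _))
  obtain ⟨N, hN⟩ := hbd
  have key : ∀ f ∈ I, ∀ n < N, f.coeff n = 0 := by
    intro f hf
    rw [← hs] at hf
    induction hf using Submodule.span_induction with
    | mem x hx => exact hN x hx
    | zero => simp
    | add x y _ _ hx hy =>
      intro n hn
      rw [HahnSeries.coeff_add, hx n hn, hy n hn, add_zero]
    | smul r x _ hx =>
      intro n hn
      by_contra hne
      rw [smul_laurent, HahnSeries.coeff_mul] at hne
      obtain ⟨p, hp, hne⟩ := Finset.exists_ne_zero_of_sum_ne_zero hne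
      rw [Finset.mem_antidiagonal] at hp
      obtain ⟨h, hh, hp1⟩ := exists_toLaurent_eq_iff.1 ⟨r, rfl⟩ _ (left_ne_zero_of_mul hne)
      exact right_ne_zero_of_mul hne (hx _ (by lia))
  refine ⟨N, fun r hr => ?_⟩
  by_contra! hlt
  have := key _ hr r hlt
  rw [monomialT, HahnSeries.coeff_single_same] at this
  exact one_ne_zero this

/-- The exponents of the monomials in a finitely generated monomial `k[[S]]`-submodule of
`k((t))`. -/
theorem exists_isApery_of_isMonomialModule (hH : IsNumericalSemigroup H) (hc : c ≠ 0)
    (hcH : c ∈ H) {I : Submodule (semigroupRing k H) (LaurentSeries k)}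
    (hI : IsMonomialModule I) (hfin : Module.Finite (semigroupRing k H) I) (hne : Nontrivial I) :
    ∃ w : Fin c → ℤ, IsApery c {r | monomialT k r ∈ I} w := by
  refine exists_isApery hc (fun n hn => monomialT_mul_mem hn hcH)
    (exists_le_of_monomialT_mem (Module.Finite.iff_fg.1 hfin)) fun i => ?_
  obtain ⟨E₀, rfl⟩ := hI
  have : E₀.Nonempty := by
    by_contra h
    rw [Set.not_nonempty_iff_eq_empty] at h
    subst h
    obtain ⟨⟨x, hx⟩, ⟨y, hy⟩, hxy⟩ := hne
    simp only [Set.image_empty, Submodule.span_empty, Submodule.mem_bot] at hx hy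
    exact hxy (Subtype.ext (hx.trans hy.symm))
  obtain ⟨e, he⟩ := this
  obtain ⟨n, hn, hd⟩ := hH.exists_mem_dvd_sub hc (i - e)
  refine ⟨e + n, ?_, ?_⟩
  · exact monomialT_mul_mem (Submodule.subset_span (Set.mem_image_of_mem _ he)) hn
  · convert hd using 1; ring

include hc hw hcH in
theorem mem_iff_of_isMonomialModule {I : Submodule (semigroupRing k H) (LaurentSeries k)}
    (hI : IsMonomialModule I) (hEI : E = {r | monomialT k r ∈ I}) {f : LaurentSeries k} :
    f ∈ I ↔ ∀ n, f.coeff n ≠ 0 → n ∈ E := by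
  obtain ⟨E₀, rfl⟩ := hI
  refine mem_span_monomialT_iff hc hw hcH ?_ ?_ ?_
  · rw [hEI]
    exact fun r hr => Submodule.subset_span ⟨r, hr, rfl⟩
  · rw [hEI]
    intro n hn h hh
    rw [Set.mem_ofPred_eq] at hn ⊢
    exact monomialT_mul_mem hn hh
  · intro i
    have := hw.mem i
    rwa [hEI] at this

theorem mem_gluedMonoid {A B : Set ℕ} {a b n : ℕ} :
    n ∈ gluedMonoid A B a b ↔
      ∃ x ∈ AddSubmonoid.closure A, ∃ y ∈ AddSubmonoid.closure B, b * x + a * y = n := by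
  have h : ∀ (c : ℕ) (A : Set ℕ), AddSubmonoid.closure ((fun x => c * x) '' A) =
      (AddSubmonoid.closure A).map (AddMonoidHom.mulLeft c) := fun c A =>
    (AddMonoidHom.map_mclosure (AddMonoidHom.mulLeft c) A).symm
  rw [gluedMonoid, AddSubmonoid.closure_union, h, h, AddSubmonoid.mem_sup]
  simp

theorem mem_gluedModule_iff {ι' : Type*} [Fintype ι'] {A B : Set ℕ} {a b : ℕ} (ha0 : a ≠ 0)
    (hb0 : b ≠ 0) (ha : a ∈ AddSubmonoid.closure A) (hab : Nat.Coprime a b)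
    {I₁ : Submodule (semigroupRing k (AddSubmonoid.closure A)) (LaurentSeries k)}
    {I₂ : Submodule (semigroupRing k (AddSubmonoid.closure B)) (LaurentSeries k)}
    {w₁ : ι → ℤ} {w₂ : ι' → ℤ} (h₁ : IsApery a {r | monomialT k r ∈ I₁} w₁)
    (h₂ : IsApery b {r | monomialT k r ∈ I₂} w₂) {f : LaurentSeries k} :
    f ∈ gluedModule A B a b I₁ I₂ ↔ ∀ n, f.coeff n ≠ 0 →
      n ∈ glueSet a b {r | monomialT k r ∈ I₁} {r | monomialT k r ∈ I₂} := by
  have hw := h₁.glue hab h₂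
  have hset : {m | ∃ r s : ℤ, monomialT k r ∈ I₁ ∧ monomialT k s ∈ I₂ ∧
      m = monomialT k ((b : ℤ) * r + (a : ℤ) * s)} = monomialT k ''
      (glueSet a b {r | monomialT k r ∈ I₁} {r | monomialT k r ∈ I₂}) := by
    ext m
    constructor
    · rintro ⟨r, s, hr, hs, rfl⟩
      exact ⟨_, ⟨r, hr, s, hs, rfl⟩, rfl⟩
    · rintro ⟨_, ⟨r, hr, s, hs, rfl⟩, rfl⟩
      exact ⟨r, s, hr, hs, rfl⟩
  rw [gluedModule, hset]
  refine mem_span_monomialT_iff (mul_ne_zero ha0 hb0) hw (fun s _ => ?_) subset_rfl ?_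
    fun i => Submodule.subset_span ⟨_, hw.mem i, rfl⟩
  · rw [mem_gluedMonoid]
    refine ⟨s • a, AddSubmonoid.nsmul_mem _ ha s, 0, zero_mem _, ?_⟩
    rw [smul_eq_mul]
    ring
  · rintro _ ⟨r, hr, s, hs, rfl⟩ h hh
    obtain ⟨x, hx, y, hy, rfl⟩ := mem_gluedMonoid.1 hh
    exact ⟨_, monomialT_mul_mem hr hx, _, monomialT_mul_mem hs hy, by push_cast; ring⟩

end MonomialModules

/-! ### Bases along ring maps, and pushout squares of local rings -/

section Bases

open TensorProduct

/-- A family that is a basis along the structure map of an algebra, as a basis. -/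
noncomputable def IsBasisAlong.basis {L R M ι : Type*} [CommRing L] [CommRing R] [AddCommGroup M]
    [Module R M] [Fintype ι] [Algebra L R] [Module L M] [IsScalarTower L R M] {e : ι → M}
    (h : IsBasisAlong (algebraMap L R) e) : Module.Basis ι L M :=
  Module.Basis.ofEquivFun (LinearEquiv.symm (LinearEquiv.ofBijective
    (Fintype.linearCombination L e) (by
      have h1 : ⇑(Fintype.linearCombination L e) = fun c => ∑ i, algebraMap L R (c i) • e i := by
        ext c
        simp [Fintype.linearCombination_apply]
      rw [h1]
      exact h)))

theorem IsBasisAlong.basis_apply {L R M ι : Type*} [CommRing L] [CommRing R] [AddCommGroup M]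
    [Module R M] [Fintype ι] [Algebra L R] [Module L M] [IsScalarTower L R M] {e : ι → M}
    (h : IsBasisAlong (algebraMap L R) e) (i : ι) : h.basis i = e i := by
  classical
  simp [IsBasisAlong.basis]

theorem IsBasisAlong.comp_equiv {L R M ι κ : Type*} [CommRing L] [CommRing R] [AddCommGroup M]
    [Module R M] [Fintype ι] [Fintype κ] {φ : L →+* R} {e : ι → M} (h : IsBasisAlong φ e)
    (σ : κ ≃ ι) : IsBasisAlong φ (e ∘ σ) := by
  have h1 : (fun c : κ → L => ∑ i, φ (c i) • (e ∘ σ) i) =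
      (fun c : ι → L => ∑ i, φ (c i) • e i) ∘ Equiv.arrowCongr σ (Equiv.refl L) := by
    ext c
    rw [Function.comp_apply, ← σ.sum_comp]
    simp [Equiv.arrowCongr]
  rw [IsBasisAlong, h1]
  exact Function.Bijective.comp h (Equiv.bijective _)

theorem isTensorProduct_of_basis {L M₁ M₂ M ι₁ ι₂ : Type*} [CommRing L] [AddCommGroup M₁]
    [AddCommGroup M₂] [AddCommGroup M] [Module L M₁] [Module L M₂] [Module L M]
    {β : M₁ →ₗ[L] M₂ →ₗ[L] M} (b₁ : Module.Basis ι₁ L M₁) (b₂ : Module.Basis ι₂ L M₂)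
    (b : Module.Basis (ι₁ × ι₂) L M) (h : ∀ i j, β (b₁ i) (b₂ j) = b (i, j)) :
    IsTensorProduct β := by
  have : TensorProduct.lift β = ((b₁.tensorProduct b₂).equiv b (Equiv.refl _)).toLinearMap := by
    refine (b₁.tensorProduct b₂).ext fun ⟨i, j⟩ => ?_
    rw [LinearEquiv.coe_coe, Module.Basis.equiv_apply, Module.Basis.tensorProduct_apply,
      TensorProduct.lift.tmul, h]
    rfl
  rw [IsTensorProduct, this]
  exact LinearEquiv.bijective _

end Bases

/-- A square of local rings `L → R₁`, `L → R₂`, `R₁ → R`, `R₂ → R` with common residue field, in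
which `R₁` and `R₂` are finite and free over `L`, and `R` is the tensor product of `R₁` and `R₂`
over `L`. -/
structure IsLocalPushout {L R₁ R₂ R : Type u} [CommRing L] [CommRing R₁] [CommRing R₂] [CommRing R]
    [IsLocalRing R₁] [IsLocalRing R₂] (φ₁ : L →+* R₁) (φ₂ : L →+* R₂) (ψ₁ : R₁ →+* R)
    (ψ₂ : R₂ →+* R) : Prop where
  comm : ψ₁.comp φ₁ = ψ₂.comp φ₂
  local_φ₁ : IsLocalHom φ₁
  local_φ₂ : IsLocalHom φ₂
  local_ψ₁ : IsLocalHom ψ₁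
  local_ψ₂ : IsLocalHom ψ₂
  res₁ : ∀ r, ∃ c, r - φ₁ c ∈ IsLocalRing.maximalIdeal R₁
  res₂ : ∀ r, ∃ c, r - φ₂ c ∈ IsLocalRing.maximalIdeal R₂
  exists_basis : ∃ (n₁ n₂ : ℕ) (f₁ : Fin n₁ → R₁) (f₂ : Fin n₂ → R₂), IsBasisAlong φ₁ f₁ ∧
    IsBasisAlong φ₂ f₂ ∧
    IsBasisAlong (ψ₁.comp φ₁) (fun p : Fin n₁ × Fin n₂ => ψ₁ (f₁ p.1) * ψ₂ (f₂ p.2))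

namespace IsLocalPushout

variable {L R₁ R₂ R : Type u} [CommRing L] [CommRing R₁] [CommRing R₂] [CommRing R]
    [IsLocalRing R₁] [IsLocalRing R₂] {φ₁ : L →+* R₁} {φ₂ : L →+* R₂} {ψ₁ : R₁ →+* R}
    {ψ₂ : R₂ →+* R}

theorem symm (h : IsLocalPushout φ₁ φ₂ ψ₁ ψ₂) : IsLocalPushout φ₂ φ₁ ψ₂ ψ₁ := by
  obtain ⟨n₁, n₂, f₁, f₂, h₁, h₂, h₃⟩ := h.exists_basis
  refine ⟨h.comm.symm, h.local_φ₂, h.local_φ₁, h.local_ψ₂, h.local_ψ₁, h.res₂, h.res₁,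
    n₂, n₁, f₂, f₁, h₂, h₁, ?_⟩
  rw [← h.comm]
  convert h₃.comp_equiv (Equiv.prodComm _ _) using 1
  ext p
  exact mul_comm _ _

theorem isPushout [Algebra L R₁] [Algebra L R₂] [Algebra L R] [Algebra R₁ R] [Algebra R₂ R]
    [IsScalarTower L R₁ R] [IsScalarTower L R₂ R]
    (h : IsLocalPushout (algebraMap L R₁) (algebraMap L R₂) (algebraMap R₁ R) (algebraMap R₂ R)) :
    Algebra.IsPushout L R₁ R₂ R ∧ (Module.Finite L R₁ ∧ Module.Free L R₁) ∧
      (Module.Finite L R₂ ∧ Module.Free L R₂) := by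
  obtain ⟨n₁, n₂, f₁, f₂, h₁, h₂, h₃⟩ := h.exists_basis
  rw [← IsScalarTower.algebraMap_eq] at h₃
  refine ⟨⟨isTensorProduct_of_basis h₁.basis h₂.basis h₃.basis fun i j => ?_⟩,
    ⟨.of_basis h₁.basis, .of_basis h₁.basis⟩, .of_basis h₂.basis, .of_basis h₂.basis⟩
  rw [h₁.basis_apply, h₂.basis_apply, h₃.basis_apply]
  simp [Algebra.smul_def]

variable {M₁ M₂ M : Type u} [AddCommGroup M₁] [Module R₁ M₁] [AddCommGroup M₂] [Module R₂ M₂]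
  [AddCommGroup M] [Module R M] {β : M₁ →+ M₂ →+ M}
  {ι₁ ι₂ : Type*} [Fintype ι₁] [Fintype ι₂] {e₁ : ι₁ → M₁} {e₂ : ι₂ → M₂}

/-- The ring maps are turned into algebra structures and the given bases exhibit M as M₁ ⊗_L M₂, so
the tensor product results apply. Keeping the maps explicit until here allows k[[t]] to act through
several substitutions. -/
theorem isSemidualizing_and [IsLocalRing R] [IsDomain L] [IsDiscreteValuationRing L]
    [IsDomain R₁] [IsDomain R₂] [IsDomain R] (h : IsLocalPushout φ₁ φ₂ ψ₁ ψ₂)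
    (hβ₁ : ∀ r x y, β (r • x) y = ψ₁ r • β x y) (hβ₂ : ∀ r x y, β x (r • y) = ψ₂ r • β x y)
    (he₁ : IsBasisAlong φ₁ e₁) (he₂ : IsBasisAlong φ₂ e₂)
    (he : IsBasisAlong (ψ₁.comp φ₁) (fun p : ι₁ × ι₂ => β (e₁ p.1) (e₂ p.2)))
    (hM₁ : IsSemidualizing R₁ M₁) (hM₂ : IsSemidualizing R₂ M₂) :
    IsSemidualizing R M ∧ (IsNontrivialSemidualizing R₁ M₁ → IsNontrivialSemidualizing R M) := by
  algebraize [φ₁, φ₂, ψ₁, ψ₂, ψ₁.comp φ₁]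
  have : IsScalarTower L R₂ R := .of_algebraMap_eq' h.comm
  let _ : Module L M₁ := Module.compHom M₁ φ₁
  let _ : Module L M₂ := Module.compHom M₂ φ₂
  let _ : Module L M := Module.compHom M (ψ₁.comp φ₁)
  let _ : Module R₁ M := Module.compHom M ψ₁
  let _ : Module R₂ M := Module.compHom M ψ₂
  have : IsScalarTower L R₁ M₁ := .of_algebraMap_smul fun _ _ => rfl
  have : IsScalarTower L R₂ M₂ := .of_algebraMap_smul fun _ _ => rfl
  have : IsScalarTower L R M := .of_algebraMap_smul fun _ _ => rfl
  have : IsScalarTower R₁ R M := .of_algebraMap_smul fun _ _ => rfl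
  have : IsScalarTower R₂ R M := .of_algebraMap_smul fun _ _ => rfl
  have : IsScalarTower L R₁ M := .of_algebraMap_smul fun _ _ => rfl
  have : IsScalarTower L R₂ M := .of_algebraMap_smul fun r x => by
    change (ψ₂.comp φ₂) r • x = (ψ₁.comp φ₁) r • x
    rw [h.comm]
  have : SMulCommClass R₁ R₂ M := ⟨fun r s x => smul_comm (ψ₁ r) (ψ₂ s) x⟩
  obtain ⟨_, ⟨_, _⟩, _, _⟩ := isPushout h
  have := h.local_φ₁
  have := h.local_φ₂
  have := h.local_ψ₁
  have := h.local_ψ₂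
  obtain ⟨ϖ, hϖ⟩ := IsDiscreteValuationRing.exists_irreducible L
  let β' : M₁ →ₗ[L] M₂ →ₗ[L] M := LinearMap.mk₂ L (fun x y => β x y)
    (fun x y z => by simp) (fun r x y => hβ₁ (φ₁ r) x y) (fun x y z => by simp)
    (fun r x y => by
      change β x (φ₂ r • y) = (ψ₁.comp φ₁) r • β x y
      rw [hβ₂, h.comm]
      rfl)
  have hβ' : IsTensorProduct β' := isTensorProduct_of_basis (L := L)
    (IsBasisAlong.basis (L := L) (R := R₁) he₁) (IsBasisAlong.basis (L := L) (R := R₂) he₂)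
    (IsBasisAlong.basis (L := L) (R := R) he) fun i j => by
      simp only [IsBasisAlong.basis_apply]
      rfl
  have : Module.Free L M₁ := .of_basis (IsBasisAlong.basis (L := L) (R := R₁) he₁)
  have : Module.Free L M₂ := .of_basis (IsBasisAlong.basis (L := L) (R := R₂) he₂)
  exact ⟨.of_isTensorProduct hβ' hβ₁ hβ₂ hM₁ hM₂, fun hM =>
    .of_isTensorProduct hϖ h.res₁ h.res₂ hβ' hβ₁ hβ₂ hM hM₂⟩

open TensorProduct in
-- D is glued with R₂, which is semidualizing over itself: R ⊗_{R₁} D = D ⊗_L R₂. No monomial basis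
-- of D is needed, since freeness over L is automatic for a semidualizing module.
theorem hasNontrivialSemidualizing [IsLocalRing R] [IsDomain L] [IsDiscreteValuationRing L]
    [IsDomain R₁] [IsDomain R₂] [IsDomain R] (h : IsLocalPushout φ₁ φ₂ ψ₁ ψ₂)
    (hD : HasNontrivialSemidualizing R₁) : HasNontrivialSemidualizing R := by
  obtain ⟨D, _, _, hD⟩ := hD
  algebraize [φ₁, φ₂, ψ₁, ψ₂, ψ₁.comp φ₁]
  have : IsScalarTower L R₂ R := .of_algebraMap_eq' h.comm
  let _ : Module L D := Module.compHom D φ₁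
  have : IsScalarTower L R₁ D := .of_algebraMap_smul fun _ _ => rfl
  have : SMulCommClass R₁ R₂ R := ⟨fun r s x => by
    simp only [Algebra.smul_def, mul_left_comm]⟩
  obtain ⟨_, ⟨_, _⟩, _, _⟩ := isPushout h
  have := h.local_φ₁
  have := h.local_φ₂
  have := h.local_ψ₁
  have := h.local_ψ₂
  obtain ⟨ϖ, hϖ⟩ := IsDiscreteValuationRing.exists_irreducible L
  have : Algebra.IsPushout L R₂ R₁ R := Algebra.IsPushout.symm inferInstance
  let β : D →ₗ[L] R₂ →ₗ[L] R ⊗[R₁] D := LinearMap.mk₂ L (fun x y => ψ₂ y ⊗ₜ x)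
    (fun x y z => TensorProduct.tmul_add _ _ _)
    (fun r x y => by rw [TensorProduct.smul_tmul', TensorProduct.smul_tmul])
    (fun x y z => by rw [map_add, TensorProduct.add_tmul])
    (fun r x y => by
      have : ψ₂ (r • y) = r • ψ₂ y := by
        rw [Algebra.smul_def, map_mul, Algebra.smul_def, IsScalarTower.algebraMap_apply L R₂ R]
        rfl
      rw [TensorProduct.smul_tmul', this])
  have hβ : IsTensorProduct β := by
    let e := TensorProduct.comm L D R₂ ≪≫ₗ
      (Algebra.IsPushout.cancelBaseChange L R₂ R₁ R D).symm.restrictScalars L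
    have h1 : TensorProduct.lift β = e.toLinearMap := TensorProduct.ext' fun x y =>
      (Algebra.IsPushout.cancelBaseChange_symm_tmul L R₂ R₁ R D y x).symm
    rw [IsTensorProduct, h1]
    exact e.bijective
  have hβ₁ : ∀ (r : R₁) x y, β (r • x) y = r • β x y := fun r x y => by
    change ψ₂ y ⊗ₜ[R₁] (r • x) = r • (ψ₂ y ⊗ₜ[R₁] x)
    rw [TensorProduct.smul_tmul', TensorProduct.smul_tmul]
  have hβ₂ : ∀ (r : R₂) x y, β x (r • y) = r • β x y := fun r x y => by
    change ψ₂ (r * y) ⊗ₜ[R₁] x = r • (ψ₂ y ⊗ₜ[R₁] x)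
    rw [TensorProduct.smul_tmul', map_mul, Algebra.smul_def]
    rfl
  exact ⟨R ⊗[R₁] D, _, _, .of_isTensorProduct hϖ h.res₁ h.res₂ hβ hβ₁ hβ₂ hD .self⟩

end IsLocalPushout

namespace IsLocalPushout

variable {L R₁ R₂ R : Type u} [CommRing L] [CommRing R₁] [CommRing R₂] [CommRing R]
    [IsLocalRing R₁] [IsLocalRing R₂] {φ₁ : L →+* R₁} {φ₂ : L →+* R₂} {ψ₁ : R₁ →+* R}
    {ψ₂ : R₂ →+* R} [IsLocalRing R] [IsDomain L] [IsDiscreteValuationRing L]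
    [IsDomain R₁] [IsDomain R₂] [IsDomain R]

theorem hasNontrivialSemidualizing_of_or (h : IsLocalPushout φ₁ φ₂ ψ₁ ψ₂)
    (hD : HasNontrivialSemidualizing R₁ ∨ HasNontrivialSemidualizing R₂) :
    HasNontrivialSemidualizing R :=
  hD.elim h.hasNontrivialSemidualizing h.symm.hasNontrivialSemidualizing

theorem isNontrivialSemidualizing_of_or {M₁ M₂ M : Type u} [AddCommGroup M₁] [Module R₁ M₁]
    [AddCommGroup M₂] [Module R₂ M₂] [AddCommGroup M] [Module R M] {β : M₁ →+ M₂ →+ M}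
    {ι₁ ι₂ : Type*} [Fintype ι₁] [Fintype ι₂] {e₁ : ι₁ → M₁} {e₂ : ι₂ → M₂}
    (h : IsLocalPushout φ₁ φ₂ ψ₁ ψ₂)
    (hβ₁ : ∀ r x y, β (r • x) y = ψ₁ r • β x y) (hβ₂ : ∀ r x y, β x (r • y) = ψ₂ r • β x y)
    (he₁ : IsBasisAlong φ₁ e₁) (he₂ : IsBasisAlong φ₂ e₂)
    (he : IsBasisAlong (ψ₁.comp φ₁) (fun p : ι₁ × ι₂ => β (e₁ p.1) (e₂ p.2)))
    (hM₁ : IsSemidualizing R₁ M₁) (hM₂ : IsSemidualizing R₂ M₂)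
    (hM : IsNontrivialSemidualizing R₁ M₁ ∨ IsNontrivialSemidualizing R₂ M₂) :
    IsNontrivialSemidualizing R M := by
  rcases hM with hM | hM
  · exact (h.isSemidualizing_and hβ₁ hβ₂ he₁ he₂ he hM₁ hM₂).2 hM
  · refine (h.symm.isSemidualizing_and (β := β.flip) (fun r x y => hβ₂ r y x)
      (fun r x y => hβ₁ r y x) he₂ he₁ ?_ hM₂ hM₁).2 hM
    rw [← h.comm]
    exact he.comp_equiv (Equiv.prodComm _ _)

end IsLocalPushout

/-! ### The gluing as a tensor product -/

section Gluing

variable {k : Type u} [Field k]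

instance isDiscreteValuationRing_semigroupRing :
    IsDiscreteValuationRing (semigroupRing k ⊤) :=
  IsDiscreteValuationRing.RingEquivClass.isDiscreteValuationRing
    (RingEquiv.ofBijective (semigroupRing k ⊤).val.toRingHom
      ⟨Subtype.val_injective, fun x => ⟨⟨x, fun _ _ => trivial⟩, rfl⟩⟩).symm

theorem exists_toLaurent_eq_monomialT {H : AddSubmonoid ℕ} {r : ℤ} (hr : ∃ h ∈ H, r = (h : ℤ)) :
    ∃ x, toLaurent H x = monomialT k r :=
  exists_toLaurent_eq_iff.2 fun n hn => by
    by_cases hnr : n = r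
    · rwa [hnr]
    · exact absurd (HahnSeries.coeff_single_of_ne hnr) hn

theorem IsNumericalSemigroup.exists_isApery {S : AddSubmonoid ℕ} (hS : IsNumericalSemigroup S)
    {c : ℕ} (hc : c ≠ 0) (hcS : c ∈ S) :
    ∃ w : Fin c → ℤ, IsApery c {n | ∃ h ∈ S, n = (h : ℤ)} w := by
  refine _root_.exists_isApery hc ?_ ⟨0, ?_⟩ fun i => ?_
  · rintro _ ⟨h, hh, rfl⟩
    exact ⟨h + c, S.add_mem hh hcS, by push_cast; rfl⟩
  · rintro _ ⟨h, hh, rfl⟩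
    exact Int.natCast_nonneg h
  · obtain ⟨n, hn, hd⟩ := hS.exists_mem_dvd_sub hc i
    exact ⟨n, ⟨n, hn, rfl⟩, hd⟩

theorem isBasisAlong_semigroupExpand_ring {ι : Type*} [Fintype ι] {c : ℕ} (hc : c ≠ 0)
    {S : AddSubmonoid ℕ} {w : ι → ℤ} (hw : IsApery c {n | ∃ h ∈ S, n = (h : ℤ)} w)
    (hcS : ∀ s ∈ (⊤ : AddSubmonoid ℕ), c * s ∈ S) (f : ι → semigroupRing k S)
    (hf : ∀ i, toLaurent S (f i) = monomialT k (w i)) :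
    IsBasisAlong (semigroupExpand c hc hcS : semigroupRing k ⊤ →+* semigroupRing k S) f :=
  isBasisAlong_semigroupExpand hc hw hcS (toLaurent S).toAddMonoidHom
    (toLaurent_injective S) (fun r x => map_mul (toLaurent S) r x)
    (fun _ => exists_toLaurent_eq_iff) f hf

variable {S₁ S₂ H : AddSubmonoid ℕ} {a b : ℕ} (ha0 : a ≠ 0) (hb0 : b ≠ 0)
  (ha : ∀ s ∈ (⊤ : AddSubmonoid ℕ), a * s ∈ S₁) (hb : ∀ s ∈ (⊤ : AddSubmonoid ℕ), b * s ∈ S₂)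
  (hH₁ : ∀ s ∈ S₁, b * s ∈ H) (hH₂ : ∀ s ∈ S₂, a * s ∈ H)

theorem semigroupExpand_comp_eq (habH : ∀ s ∈ (⊤ : AddSubmonoid ℕ), a * b * s ∈ H) :
    (semigroupExpand b hb0 hH₁).comp (semigroupExpand a ha0 ha) =
      (semigroupExpand (a * b) (mul_ne_zero ha0 hb0) habH :
        semigroupRing k ⊤ →+* semigroupRing k H) :=
  semigroupExpand_comp _ _ _ _ _ _ _ _ _ (mul_comm b a)

/-- The bases are the monomials with exponents in Apéry sets of S₁ modulo a and S₂ modulo b; their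
products have exponents b w₁ + a w₂, an Apéry set of H modulo ab. -/
theorem isLocalPushout_semigroupExpand (h₁ : IsNumericalSemigroup S₁)
    (h₂ : IsNumericalSemigroup S₂) (hab : Nat.Coprime a b)
    (hH : ∀ n, n ∈ H ↔ ∃ x ∈ S₁, ∃ y ∈ S₂, b * x + a * y = n) :
    IsLocalPushout (semigroupExpand a ha0 ha : semigroupRing k ⊤ →+* semigroupRing k S₁)
      (semigroupExpand b hb0 hb : semigroupRing k ⊤ →+* semigroupRing k S₂)
      (semigroupExpand b hb0 hH₁ : semigroupRing k S₁ →+* semigroupRing k H)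
      (semigroupExpand a ha0 hH₂) := by
  have habH : ∀ s ∈ (⊤ : AddSubmonoid ℕ), a * b * s ∈ H := fun s hs => by
    rw [mul_comm a b, mul_assoc]
    exact hH₁ _ (ha s hs)
  have hcomp := semigroupExpand_comp_eq (k := k) ha0 hb0 ha hH₁ habH
  refine ⟨?_, isLocalHom_semigroupExpand _ _ _, isLocalHom_semigroupExpand _ _ _,
    isLocalHom_semigroupExpand _ _ _, isLocalHom_semigroupExpand _ _ _,
    exists_sub_semigroupExpand_mem _ _ _, exists_sub_semigroupExpand_mem _ _ _, ?_⟩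
  · rw [hcomp]
    exact (semigroupExpand_comp _ _ _ _ _ _ _ _ _ rfl).symm
  · obtain ⟨w₁, hw₁⟩ := h₁.exists_isApery ha0 (by simpa using ha 1 trivial)
    obtain ⟨w₂, hw₂⟩ := h₂.exists_isApery hb0 (by simpa using hb 1 trivial)
    choose f₁ hf₁ using fun i => exists_toLaurent_eq_monomialT (k := k) (hw₁.mem i)
    choose f₂ hf₂ using fun i => exists_toLaurent_eq_monomialT (k := k) (hw₂.mem i)
    refine ⟨a, b, f₁, f₂, isBasisAlong_semigroupExpand_ring ha0 hw₁ ha f₁ hf₁,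
      isBasisAlong_semigroupExpand_ring hb0 hw₂ hb f₂ hf₂, ?_⟩
    have hset : glueSet a b {n | ∃ h ∈ S₁, n = (h : ℤ)} {n | ∃ h ∈ S₂, n = (h : ℤ)} =
        {n | ∃ h ∈ H, n = (h : ℤ)} := by
      ext n
      constructor
      · rintro ⟨_, ⟨x, hx, rfl⟩, _, ⟨y, hy, rfl⟩, rfl⟩
        exact ⟨b * x + a * y, (hH _).2 ⟨x, hx, y, hy, rfl⟩, by push_cast; rfl⟩
      · rintro ⟨h, hh, rfl⟩
        obtain ⟨x, hx, y, hy, rfl⟩ := (hH _).1 hh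
        exact ⟨_, ⟨x, hx, rfl⟩, _, ⟨y, hy, rfl⟩, by push_cast; rfl⟩
    have hw := hw₁.glue hab hw₂
    rw [hset] at hw
    rw [hcomp]
    refine isBasisAlong_semigroupExpand_ring (mul_ne_zero ha0 hb0) hw habH _ fun p => ?_
    rw [map_mul, ← laurentExpand_toLaurent, ← laurentExpand_toLaurent, hf₁, hf₂,
      laurentExpand_monomialT, laurentExpand_monomialT, monomialT_mul]

theorem laurentExpand_mul_coeff_ne_zero {E₁ E₂ : Set ℤ} {f g : LaurentSeries k}
    (hf : ∀ n, f.coeff n ≠ 0 → n ∈ E₁) (hg : ∀ n, g.coeff n ≠ 0 → n ∈ E₂) (n : ℤ)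
    (hn : (laurentExpand b hb0 f * laurentExpand a ha0 g).coeff n ≠ 0) :
    n ∈ glueSet a b E₁ E₂ := by
  rw [HahnSeries.coeff_mul] at hn
  obtain ⟨p, hp, hne⟩ := Finset.exists_ne_zero_of_sum_ne_zero hn
  rw [Finset.mem_antidiagonal] at hp
  obtain ⟨r, hr⟩ := not_imp_comm.1 (coeff_laurentExpand_of_not_dvd b hb0 f)
    (left_ne_zero_of_mul hne)
  obtain ⟨s, hs⟩ := not_imp_comm.1 (coeff_laurentExpand_of_not_dvd a ha0 g)
    (right_ne_zero_of_mul hne)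
  rw [hr, coeff_laurentExpand_mul, hs, coeff_laurentExpand_mul] at hne
  exact ⟨r, hf r (left_ne_zero_of_mul hne), s, hg s (right_ne_zero_of_mul hne), by
    rw [← hr, ← hs, hp.2.2]⟩

theorem isBasisAlong_semigroupExpand_submodule {ι : Type*} [Fintype ι] {c : ℕ} (hc : c ≠ 0)
    {E : Set ℤ} {w : ι → ℤ} (hw : IsApery c E w)
    (hcH : ∀ s ∈ (⊤ : AddSubmonoid ℕ), c * s ∈ H)
    {I : Submodule (semigroupRing k H) (LaurentSeries k)}
    (hI : ∀ f, f ∈ I ↔ ∀ n, f.coeff n ≠ 0 → n ∈ E) (e : ι → I)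
    (he : ∀ i, (e i : LaurentSeries k) = monomialT k (w i)) :
    IsBasisAlong (semigroupExpand c hc hcH : semigroupRing k ⊤ →+* semigroupRing k H) e :=
  isBasisAlong_semigroupExpand hc hw hcH I.subtype.toAddMonoidHom Subtype.val_injective
    (fun r x => smul_laurent r x.1) (fun f => by
      rw [← hI]
      exact ⟨fun ⟨x, hx⟩ => hx ▸ x.2, fun hf => ⟨⟨f, hf⟩, rfl⟩⟩) e he

variable {I₁ : Submodule (semigroupRing k S₁) (LaurentSeries k)}
  {I₂ : Submodule (semigroupRing k S₂) (LaurentSeries k)}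
  {I : Submodule (semigroupRing k H) (LaurentSeries k)} {E₁ E₂ : Set ℤ}
  (hI₁ : ∀ f, f ∈ I₁ ↔ ∀ n, f.coeff n ≠ 0 → n ∈ E₁)
  (hI₂ : ∀ f, f ∈ I₂ ↔ ∀ n, f.coeff n ≠ 0 → n ∈ E₂)
  (hI : ∀ f, f ∈ I ↔ ∀ n, f.coeff n ≠ 0 → n ∈ glueSet a b E₁ E₂)

/-- A shortcut for instance search. -/
noncomputable instance smulSubmoduleLaurent (J : Submodule (semigroupRing k H) (LaurentSeries k)) :
    SMul (semigroupRing k H) J :=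
  J.module.toDistribMulAction.toMulAction.toSemigroupAction.toSMul

/-- The map `(f, g) ↦ f(t ^ b) g(t ^ a)`. -/
noncomputable def glueMap : I₁ →+ I₂ →+ I :=
  AddMonoidHom.mk' (fun f => AddMonoidHom.mk' (fun g =>
    ⟨laurentExpand b hb0 f.1 * laurentExpand a ha0 g.1, (hI _).2
      (laurentExpand_mul_coeff_ne_zero ha0 hb0 ((hI₁ _).1 f.2) ((hI₂ _).1 g.2))⟩)
    fun g g' => Subtype.ext (by simp [mul_add]))
    fun f f' => by ext g : 2; simp [add_mul]

theorem coe_glueMap (f : I₁) (g : I₂) : (glueMap ha0 hb0 hI₁ hI₂ hI f g : LaurentSeries k) =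
    laurentExpand b hb0 f.1 * laurentExpand a ha0 g.1 := rfl

theorem glueMap_smul_left (r : semigroupRing k S₁) (f : I₁) (g : I₂) :
    glueMap ha0 hb0 hI₁ hI₂ hI (r • f) g =
      semigroupExpand b hb0 hH₁ r • glueMap ha0 hb0 hI₁ hI₂ hI f g :=
  Subtype.ext (by
    rw [coe_glueMap, Submodule.coe_smul, Submodule.coe_smul, smul_laurent, smul_laurent,
      coe_glueMap, map_mul, laurentExpand_toLaurent b hb0 hH₁, mul_assoc])

theorem glueMap_smul_right (r : semigroupRing k S₂) (f : I₁) (g : I₂) :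
    glueMap ha0 hb0 hI₁ hI₂ hI f (r • g) =
      semigroupExpand a ha0 hH₂ r • glueMap ha0 hb0 hI₁ hI₂ hI f g :=
  Subtype.ext (by
    rw [coe_glueMap, Submodule.coe_smul, Submodule.coe_smul, smul_laurent, smul_laurent,
      coe_glueMap, map_mul, laurentExpand_toLaurent a ha0 hH₂, mul_left_comm])

include ha0 hb0 hI₁ hI₂ hI ha hb in
-- `glueMap` sends pairs of Apéry monomials of I₁ and I₂ to the Apéry monomials of I, so it exhibits
-- I as the tensor product of I₁ and I₂ over k[[t]].
theorem gluing_of_mem_iff (h₁ : IsNumericalSemigroup S₁)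
    (h₂ : IsNumericalSemigroup S₂) (hab : Nat.Coprime a b)
    (hH : ∀ n, n ∈ H ↔ ∃ x ∈ S₁, ∃ y ∈ S₂, b * x + a * y = n)
    {w₁ : Fin a → ℤ} {w₂ : Fin b → ℤ} (hw₁ : IsApery a E₁ w₁) (hw₂ : IsApery b E₂ w₂)
    (hC₁ : IsSemidualizing (semigroupRing k S₁) I₁)
    (hC₂ : IsSemidualizing (semigroupRing k S₂) I₂) :
    IsSemidualizing (semigroupRing k H) I ∧
    (IsNontrivialSemidualizing (semigroupRing k S₁) I₁ ∨
        IsNontrivialSemidualizing (semigroupRing k S₂) I₂ →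
      IsNontrivialSemidualizing (semigroupRing k H) I) ∧
    (HasNontrivialSemidualizing (semigroupRing k S₁) ∨
        HasNontrivialSemidualizing (semigroupRing k S₂) →
      HasNontrivialSemidualizing (semigroupRing k H)) := by
  have hH₁ : ∀ s ∈ S₁, b * s ∈ H := fun s hs => (hH _).2 ⟨s, hs, 0, zero_mem _, by simp⟩
  have hH₂ : ∀ s ∈ S₂, a * s ∈ H := fun s hs => (hH _).2 ⟨0, zero_mem _, s, hs, by simp⟩
  have habH : ∀ s ∈ (⊤ : AddSubmonoid ℕ), a * b * s ∈ H := fun s hs => by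
    rw [mul_comm a b, mul_assoc]
    exact hH₁ _ (ha s hs)
  have hpush := isLocalPushout_semigroupExpand (k := k) ha0 hb0 ha hb hH₁ hH₂ h₁ h₂ hab hH
  have hmem : ∀ {S : AddSubmonoid ℕ} {J : Submodule (semigroupRing k S) (LaurentSeries k)}
      {E : Set ℤ} (_ : ∀ f, f ∈ J ↔ ∀ n, f.coeff n ≠ 0 → n ∈ E) {r : ℤ} (_ : r ∈ E),
      monomialT k r ∈ J := fun hJ r hr => (hJ _).2 fun n hn => by
    by_cases hnr : n = r
    · rwa [hnr]
    · exact absurd (HahnSeries.coeff_single_of_ne hnr) hn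
  let e₁ : Fin a → I₁ := fun i => ⟨_, hmem hI₁ (hw₁.mem i)⟩
  let e₂ : Fin b → I₂ := fun i => ⟨_, hmem hI₂ (hw₂.mem i)⟩
  have he₁ := isBasisAlong_semigroupExpand_submodule ha0 hw₁ ha hI₁ e₁ fun _ => rfl
  have he₂ := isBasisAlong_semigroupExpand_submodule hb0 hw₂ hb hI₂ e₂ fun _ => rfl
  have he := isBasisAlong_semigroupExpand_submodule (mul_ne_zero ha0 hb0) (hw₁.glue hab hw₂) habH
    hI (fun p => glueMap ha0 hb0 hI₁ hI₂ hI (e₁ p.1) (e₂ p.2)) fun p => by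
      rw [coe_glueMap, laurentExpand_monomialT, laurentExpand_monomialT, monomialT_mul]
  rw [← semigroupExpand_comp_eq ha0 hb0 ha hH₁ habH] at he
  have hβ₁ := glueMap_smul_left ha0 hb0 hH₁ hI₁ hI₂ hI
  have hβ₂ := glueMap_smul_right ha0 hb0 hH₂ hI₁ hI₂ hI
  exact ⟨(hpush.isSemidualizing_and hβ₁ hβ₂ he₁ he₂ he hC₁ hC₂).1,
    hpush.isNontrivialSemidualizing_of_or hβ₁ hβ₂ he₁ he₂ he hC₁ hC₂,
    hpush.hasNontrivialSemidualizing_of_or⟩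

end Gluing

section

variable {k : Type u} [Field k] {A B : Set ℕ} {a b : ℕ}

theorem gluing_of_ne_zero (hA : IsNumericalSemigroup (AddSubmonoid.closure A))
    (hB : IsNumericalSemigroup (AddSubmonoid.closure B))
    (ha : a ∈ AddSubmonoid.closure A) (hb : b ∈ AddSubmonoid.closure B)
    (hab : Nat.Coprime a b) (ha0 : a ≠ 0) (hb0 : b ≠ 0)
    {I₁ : Submodule (semigroupRing k (AddSubmonoid.closure A)) (LaurentSeries k)}
    {I₂ : Submodule (semigroupRing k (AddSubmonoid.closure B)) (LaurentSeries k)}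
    (hI₁ : IsMonomialModule I₁) (hI₂ : IsMonomialModule I₂)
    (hC₁ : IsSemidualizing (semigroupRing k (AddSubmonoid.closure A)) I₁)
    (hC₂ : IsSemidualizing (semigroupRing k (AddSubmonoid.closure B)) I₂) :
    IsSemidualizing (semigroupRing k (gluedMonoid A B a b)) (gluedModule A B a b I₁ I₂) ∧
    (IsNontrivialSemidualizing (semigroupRing k (AddSubmonoid.closure A)) I₁ ∨
        IsNontrivialSemidualizing (semigroupRing k (AddSubmonoid.closure B)) I₂ →
      IsNontrivialSemidualizing (semigroupRing k (gluedMonoid A B a b))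
        (gluedModule A B a b I₁ I₂)) ∧
    (HasNontrivialSemidualizing (semigroupRing k (AddSubmonoid.closure A)) ∨
        HasNontrivialSemidualizing (semigroupRing k (AddSubmonoid.closure B)) →
      HasNontrivialSemidualizing (semigroupRing k (gluedMonoid A B a b))) := by
  have ha' : ∀ s ∈ (⊤ : AddSubmonoid ℕ), a * s ∈ AddSubmonoid.closure A := fun s _ => by
    rw [mul_comm, ← smul_eq_mul]
    exact AddSubmonoid.nsmul_mem _ ha s
  have hb' : ∀ s ∈ (⊤ : AddSubmonoid ℕ), b * s ∈ AddSubmonoid.closure B := fun s _ => by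
    rw [mul_comm, ← smul_eq_mul]
    exact AddSubmonoid.nsmul_mem _ hb s
  -- Finite generation bounds the exponents below, and a nonzero module has exponents in every
  -- residue class.
  obtain ⟨w₁, hw₁⟩ := exists_isApery_of_isMonomialModule hA ha0 ha hI₁ hC₁.finite hC₁.nontrivial
  obtain ⟨w₂, hw₂⟩ := exists_isApery_of_isMonomialModule hB hb0 hb hI₂ hC₂.finite hC₂.nontrivial
  exact gluing_of_mem_iff ha0 hb0 ha' hb'
    (fun f => mem_iff_of_isMonomialModule ha0 hw₁ ha' hI₁ rfl)
    (fun f => mem_iff_of_isMonomialModule hb0 hw₂ hb' hI₂ rfl)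
    (fun f => mem_gluedModule_iff ha0 hb0 ha hab hw₁ hw₂) hA hB hab (fun _ => mem_gluedMonoid)
    hw₁ hw₂ hC₁ hC₂

end

/-! ### The degenerate cases a = 0 and b = 0 -/

section Degenerate

variable {k : Type u} [Field k]

/-- After identifying H with S₁ the two modules have the same generators, so nothing changes; the
factor k[[t]] has no nontrivial semidualizing module to contribute. -/
theorem gluing_of_eq_top {S₁ S₂ H : AddSubmonoid ℕ}
    {I₁ : Submodule (semigroupRing k S₁) (LaurentSeries k)}
    {I₂ : Submodule (semigroupRing k S₂) (LaurentSeries k)}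
    {I : Submodule (semigroupRing k H) (LaurentSeries k)} (hH : H = S₁) (hS₂ : S₂ = ⊤)
    (hI : ∃ s, I = Submodule.span (semigroupRing k H) s ∧ I₁ = Submodule.span (semigroupRing k S₁) s)
    (hC₁ : IsSemidualizing (semigroupRing k S₁) I₁) :
    IsSemidualizing (semigroupRing k H) I ∧
    (IsNontrivialSemidualizing (semigroupRing k S₁) I₁ ∨
        IsNontrivialSemidualizing (semigroupRing k S₂) I₂ →
      IsNontrivialSemidualizing (semigroupRing k H) I) ∧
    (HasNontrivialSemidualizing (semigroupRing k S₁) ∨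
        HasNontrivialSemidualizing (semigroupRing k S₂) →
      HasNontrivialSemidualizing (semigroupRing k H)) := by
  subst hH hS₂
  obtain ⟨s, rfl, rfl⟩ := hI
  have h2 : ¬ HasNontrivialSemidualizing (semigroupRing k (⊤ : AddSubmonoid ℕ)) :=
    not_hasNontrivialSemidualizing_of_dvr
  exact ⟨hC₁, fun h => h.elim id fun h => absurd ⟨_, _, _, h⟩ h2, fun h => h.elim id fun h =>
    absurd h h2⟩

theorem IsMonomialModule.eq_span {H : AddSubmonoid ℕ}
    {I : Submodule (semigroupRing k H) (LaurentSeries k)} (hI : IsMonomialModule I) :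
    I = Submodule.span (semigroupRing k H) (monomialT k '' {r | monomialT k r ∈ I}) := by
  refine le_antisymm ?_ (Submodule.span_le.2 ?_)
  · obtain ⟨E, rfl⟩ := hI
    exact Submodule.span_mono (Set.image_mono fun r hr => Submodule.subset_span ⟨r, hr, rfl⟩)
  · rintro _ ⟨r, hr, rfl⟩
    exact hr

theorem IsMonomialModule.exists_mem {H : AddSubmonoid ℕ}
    {I : Submodule (semigroupRing k H) (LaurentSeries k)} (hI : IsMonomialModule I)
    (hne : Nontrivial I) : ∃ r, monomialT k r ∈ I := by
  by_contra! h
  obtain ⟨⟨x, hx⟩, ⟨y, hy⟩, hxy⟩ := hne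
  have h0 : {r | monomialT k r ∈ I} = ∅ := Set.eq_empty_of_forall_notMem h
  rw [hI.eq_span, h0, Set.image_empty, Submodule.span_empty, Submodule.mem_bot] at hx hy
  exact hxy (Subtype.ext (hx.trans hy.symm))

theorem AddSubmonoid.eq_top_of_one_mem {S : AddSubmonoid ℕ} (h : 1 ∈ S) : S = ⊤ :=
  eq_top_iff.2 fun n _ => by simpa using S.nsmul_mem h n

end Degenerate

theorem theorem5p7 {k : Type u} [Field k] (A B : Set ℕ)
    (hA : IsNumericalSemigroup (AddSubmonoid.closure A))
    (hB : IsNumericalSemigroup (AddSubmonoid.closure B))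
    (a b : ℕ) (ha : a ∈ AddSubmonoid.closure A) (hb : b ∈ AddSubmonoid.closure B)
    (hab : Nat.Coprime a b)
    (I₁ : Submodule (semigroupRing k (AddSubmonoid.closure A)) (LaurentSeries k))
    (I₂ : Submodule (semigroupRing k (AddSubmonoid.closure B)) (LaurentSeries k))
    (hI₁ : IsMonomialModule I₁) (hI₂ : IsMonomialModule I₂)
    (hC₁ : IsSemidualizing (semigroupRing k (AddSubmonoid.closure A)) I₁)
    (hC₂ : IsSemidualizing (semigroupRing k (AddSubmonoid.closure B)) I₂) :
    IsSemidualizing (semigroupRing k (gluedMonoid A B a b)) (gluedModule A B a b I₁ I₂) ∧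
    (IsNontrivialSemidualizing (semigroupRing k (AddSubmonoid.closure A)) I₁ ∨
        IsNontrivialSemidualizing (semigroupRing k (AddSubmonoid.closure B)) I₂ →
      IsNontrivialSemidualizing (semigroupRing k (gluedMonoid A B a b))
        (gluedModule A B a b I₁ I₂)) ∧
    (HasNontrivialSemidualizing (semigroupRing k (AddSubmonoid.closure A)) ∨
        HasNontrivialSemidualizing (semigroupRing k (AddSubmonoid.closure B)) →
      HasNontrivialSemidualizing (semigroupRing k (gluedMonoid A B a b))) := by
  rcases eq_or_ne a 0 with rfl | ha0
  -- gcd(0, b) = b, so b = 1, which forces ⟨B⟩ = ℕ and H = ⟨A⟩.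
  · obtain rfl : b = 1 := by simpa using hab
    refine gluing_of_eq_top (I₁ := I₁) (I₂ := I₂) ?_ (AddSubmonoid.eq_top_of_one_mem hb)
      ⟨_, rfl, hI₁.eq_span.trans ?_⟩ hC₁
    · ext n
      rw [mem_gluedMonoid]
      exact ⟨fun ⟨x, hx, y, _, h⟩ => by simpa [← h] using hx,
        fun hn => ⟨n, hn, 0, zero_mem _, by simp⟩⟩
    -- The generators of I are the t^r with t^r in I₁, provided that I₂ contains at least one
    -- monomial t^s.
    · obtain ⟨s, hs⟩ := hI₂.exists_mem hC₂.nontrivial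
      congr 1
      ext m
      constructor
      · rintro ⟨r, hr, rfl⟩
        exact ⟨r, s, hr, hs, by simp⟩
      · rintro ⟨r, s, hr, _, rfl⟩
        exact ⟨r, hr, by simp⟩
  rcases eq_or_ne b 0 with rfl | hb0
  · obtain rfl : a = 1 := by simpa using hab
    have := gluing_of_eq_top (I₁ := I₂) (I₂ := I₁) (I := gluedModule A B 1 0 I₁ I₂) ?_
      (AddSubmonoid.eq_top_of_one_mem ha) ⟨_, rfl, hI₂.eq_span.trans ?_⟩ hC₂
    · exact ⟨this.1, fun h => this.2.1 h.symm, fun h => this.2.2 h.symm⟩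
    · ext n
      rw [mem_gluedMonoid]
      exact ⟨fun ⟨x, _, y, hy, h⟩ => by simpa [← h] using hy,
        fun hn => ⟨0, zero_mem _, n, hn, by simp⟩⟩
    · obtain ⟨r, hr⟩ := hI₁.exists_mem hC₁.nontrivial
      congr 1
      ext m
      constructor
      · rintro ⟨s, hs, rfl⟩
        exact ⟨r, s, hr, hs, by simp⟩
      · rintro ⟨r, s, _, hs, rfl⟩
        exact ⟨s, hs, by simp⟩
  exact gluing_of_ne_zero hA hB ha hb hab ha0 hb0 hI₁ hI₂ hC₁ hC₂
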